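/- Let $s$ be an analytic function on the upper half-plane $\mathbb C_+$ with $|s|\le 1$, $s(i)=0$, and, for all $\alpha\in[0,\pi)$ and $\varepsilon>0$, $z(s(z)-e^{2i\alpha})\to\infty$ as $z\to\infty$ in the sector $\varepsilon\le\arg z\le\pi-\varepsilon$. Let $|\varkappa|<1$ and put $$S(z)=\frac{s(z)-\varkappa}{\overline{\varkappa}\,s(z)-1},\qquad M(z)=\frac1i\cdot\frac{s(z)+1}{s(z)-1},\qquad z\in\mathbb C_+ .$$ Let $\mu$ be the Borel measure on $\mathbb R$ with $\mu(\mathbb R)=\infty$, $\int_{\mathbb R}\frac{d\mu(\lambda)}{1+\lambda^2}=1$ and $$M(z)=\int_{\mathbb R}\Big(\frac1{\lambda-z}-\frac{\lambda}{1+\lambda^2}\Big)d\mu(\lambda),\qquad z\in\mathbb C_+ .$$ In $L^2(\mathbb R;d\mu)$ let $\mathcal B$ be the self-adjoint operator of multiplication by the independent variable on its maximal domain, let $\dot{\mathcal B}$ be its restriction to $\{f\in\mathrm{Dom}(\mathcal B):\int f\,d\mu=0\}$, and let $\widehat{\mathcal B}$ be the restriction of $(\dot{\mathcal B})^*$ to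 $\mathrm{Dom}(\dot{\mathcal B})\dot+\mathrm{span}\{\frac1{\lambda-i}-\varkappa\frac1{\lambda+i}\}$ (the model triple $\mathfrak B=(\dot{\mathcal B},\widehat{\mathcal B},\mathcal B)$). The characteristic function $S_{\mathfrak A}$ of a triple $\mathfrak A=(\dot A,\widehat A,A)$, where $\dot A$ is a densely defined symmetric operator with deficiency indices $(1,1)$, $A$ is a self-adjoint extension of $\dot A$ and $\widehat A\neq\widehat A^*$ is a maximal dissipative extension of $\dot A$, is $$S_{\mathfrak A}(z)=\frac{s_{\mathfrak A}(z)-\varkappa_{\mathfrak A}}{\overline{\varkappa_{\mathfrak A}}\,s_{\mathfrak A}(z)-1},\qquad s_{\mathfrak A}(z)=\frac{z-i}{z+i}\cdot\frac{(g_z,g_-)}{(g_z,g_+)},\qquad z\in\mathbb C_+,$$ where $g_\pm\in\mathrm{Ker}(\dot A^*\mp iI)$, $\|g_\pm\|=1$, $g_+-g_-\in\mathrm{Dom}(A)$, $0\ne g_z\in\mathrm{Ker}(\dot A^*-zI)$, and $\varkappa_{\mathfrak A}$, $|\varkappa_{\mathfrak A}|<1$, is determined by $g_+-\varkappa_{\mathfrak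 A}g_-\in\mathrm{Dom}(\widehat A)$. The Livšic characteristic function of a bounded dissipative operator $T$ whose imaginary part $\Im T=\frac{1}{2i}(T-T^*)$ has rank one is $$S_T(z)=1+2i\,\mathrm{tr}\big[(T^*-zI)^{-1}\,\Im T\big],\qquad z\in\mathbb C_+ .$$ The characteristic function of the model triple is $S_{\mathfrak B}=S$. Assume that $0$ is a quasi-regular point of $\dot{\mathcal B}$, that is, $\|\dot{\mathcal B}f\|\ge k\|f\|$ for some $k>0$ and all $f\in\mathrm{Dom}(\dot{\mathcal B})$. Then $\widehat{\mathcal B}$ has a bounded inverse defined on the whole space, $-\widehat{\mathcal B}^{-1}$ is dissipative with imaginary part of rank one, the boundary value $S_{\mathfrak B}(0+i0)=\lim_{z\to0,\ z\in\mathbb C_+}S_{\mathfrak B}(z)$ exists and is nonzero, and $$S_{-\widehat{\mathcal B}^{-1}}\Big(-\frac1z\Big)=\frac{S_{\mathfrak B}(z)}{S_{\mathfrak B}(0+i0)},\qquad z\in\mathbb C_+ .$$ -/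

import Mathlib

open MeasureTheory Complex
open scoped ComplexStarModule

noncomputable section

/-! ### Unbounded operators in a Hilbert space -/

section Operators

variable {H : Type*} [NormedAddCommGroup H] [InnerProductSpace ℂ H]

/-- `z` is a quasi-regular point (a point of regular type) of `A`: the operator `A - z` is
injective and its inverse is continuous on the range of `A - z`. -/
def IsQuasiRegularPoint (A : H →ₗ.[ℂ] H) (z : ℂ) : Prop :=
  ∃ k : ℝ, 0 < k ∧ ∀ f : A.domain, k * ‖(f : H)‖ ≤ ‖A f - z • (f : H)‖

/-- `T` is the bounded, everywhere defined inverse of `A`: one has `f ∈ Dom A` and `A f = h`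
if and only if `T h = f`. -/
def IsBoundedInverse (A : H →ₗ.[ℂ] H) (T : H →L[ℂ] H) : Prop :=
  ∀ f h : H, (f, h) ∈ A.graph ↔ T h = f

/-- The bounded operator `T` is dissipative: `Im (T f, f) ≥ 0`. (Mathlib's inner product is
linear in the second argument, so `(T f, f)` is `inner ℂ f (T f)`.) -/
def IsBoundedDissipative (T : H →L[ℂ] H) : Prop :=
  ∀ f : H, 0 ≤ (inner ℂ f (T f)).im

/-- The trace of a finite-rank operator, computed on its (finite-dimensional) range. -/
def finiteRankTrace (F : H →L[ℂ] H) : ℂ :=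
  LinearMap.trace ℂ (LinearMap.range (F : H →ₗ[ℂ] H))
    ((F : H →ₗ[ℂ] H).rangeRestrict ∘ₗ (LinearMap.range (F : H →ₗ[ℂ] H)).subtype)

variable [CompleteSpace H]

/-- The Livšic characteristic function of a bounded dissipative operator `T` whose imaginary part
`Im T = (T - T^*) / (2i)` has rank one:
`S_T(z) = 1 + 2i tr [(T^* - z)⁻¹ Im T]`, `Im z > 0`.
(As `T` is dissipative, every such `z` lies in the resolvent set of `T^*`.) -/
def livsicCharacteristicFunction (T : H →L[ℂ] H) (z : ℂ) : ℂ :=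
  1 + 2 * I * finiteRankTrace
    (Ring.inverse (ContinuousLinearMap.adjoint T - z • (1 : H →L[ℂ] H)) * (ℑ T : H →L[ℂ] H))

/-- `g ∈ Ker (A^* - z)`. -/
def IsDeficiencyElement (A : H →ₗ.[ℂ] H) (z : ℂ) (g : H) : Prop :=
  (g, z • g) ∈ A.adjoint.graph

/-- `S` is, on the upper half-plane, the characteristic function of the triple
`(Adot, Ahat, A)`: with normalized deficiency elements `g₊ ∈ Ker (Adot^* - i)`,
`g₋ ∈ Ker (Adot^* + i)` such that `g₊ - g₋ ∈ Dom A`, with the von Neumann parameter `κ`,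
`|κ| < 1`, `g₊ - κ g₋ ∈ Dom Ahat`, and with the Livšic function
`s(z) = (z - i) / (z + i) * (g_z, g₋) / (g_z, g₊)`, `0 ≠ g_z ∈ Ker (Adot^* - z)`, one has
`S(z) = (s(z) - κ) / (conj κ * s(z) - 1)`. -/
def IsTripleCharacteristicFunction (Adot Ahat A : H →ₗ.[ℂ] H) (S : ℂ → ℂ) : Prop :=
  ∃ (gp gm : H) (κ : ℂ),
    IsDeficiencyElement Adot I gp ∧ IsDeficiencyElement Adot (-I) gm ∧
    ‖gp‖ = 1 ∧ ‖gm‖ = 1 ∧ gp - gm ∈ A.domain ∧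
    ‖κ‖ < 1 ∧ gp - κ • gm ∈ Ahat.domain ∧
    ∀ z : ℂ, 0 < z.im → ∃ g : H, g ≠ 0 ∧ IsDeficiencyElement Adot z g ∧
      inner ℂ gp g ≠ 0 ∧
      ∃ s : ℂ, s = (z - I) / (z + I) * (inner ℂ gm g / inner ℂ gp g) ∧
        S z = (s - κ) / ((starRingEnd ℂ) κ * s - 1)

end Operators

/-! ### The model triple -/

/-- The parameters of the functional model. The function `s` is analytic and contractive in the
upper half-plane and satisfies the Livšic criterion, `|κ| < 1`,
`S = (s - κ) / (conj κ * s - 1)`, and `μ` is the infinite Borel measure with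
`∫ dμ(x) / (1 + x²) = 1` which represents the function `M = (1 / i) (s + 1) / (s - 1)`. -/
structure IsModelData (S s : ℂ → ℂ) (κ : ℂ) (μ : Measure ℝ) : Prop where
  analytic : DifferentiableOn ℂ s {z | 0 < z.im}
  contractive : ∀ z : ℂ, 0 < z.im → ‖s z‖ ≤ 1
  livsic_at_I : s I = 0
  livsic_at_infty : ∀ α ∈ Set.Ico (0 : ℝ) Real.pi, ∀ ε : ℝ, 0 < ε →
    Filter.Tendsto (fun z : ℂ => z * (s z - exp (2 * I * α)))
      (Bornology.cobounded ℂ ⊓ Filter.principal {z | ε ≤ arg z ∧ arg z ≤ Real.pi - ε})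
      (Bornology.cobounded ℂ)
  norm_kappa_lt : ‖κ‖ < 1
  S_eq : ∀ z : ℂ, 0 < z.im → S z = (s z - κ) / ((starRingEnd ℂ) κ * s z - 1)
  measure_univ : μ Set.univ = ⊤
  normalized : ∫⁻ x : ℝ, ENNReal.ofReal (1 / (1 + x ^ 2)) ∂μ = 1
  representation : ∀ z : ℂ, 0 < z.im →
    (1 / I) * ((s z + 1) / (s z - 1)) =
      ∫ x : ℝ, (1 / ((x : ℂ) - z) - (x : ℂ) / (1 + (x : ℂ) ^ 2)) ∂μ

/-- The self-adjoint operator of multiplication by the independent variable in `L²(ℝ; μ)`, on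
its maximal domain. -/
def modelB (μ : Measure ℝ) : Lp ℂ 2 μ →ₗ.[ℂ] Lp ℂ 2 μ where
  domain :=
    { carrier := {f | MemLp (fun x : ℝ => (x : ℂ) * f x) 2 μ}
      zero_mem' := by
        refine (memLp_congr_ae ?_).2 (MemLp.zero (ε := ℂ) (p := 2) (μ := μ))
        filter_upwards [Lp.coeFn_zero ℂ 2 μ] with x hx
        have hx' := congrArg (fun w : ℂ => (x : ℂ) * w) hx
        simpa only [Pi.zero_apply, mul_zero] using hx'
      add_mem' := by
        intro f g hf hg
        refine (memLp_congr_ae ?_).2 (MemLp.add hf hg)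
        filter_upwards [Lp.coeFn_add f g] with x hx
        have hx' := congrArg (fun w : ℂ => (x : ℂ) * w) hx
        simpa only [Pi.add_apply, mul_add] using hx'
      smul_mem' := by
        intro c f hf
        refine (memLp_congr_ae ?_).2 (MemLp.const_smul hf c)
        filter_upwards [Lp.coeFn_smul c f] with x hx
        simp [hx, mul_left_comm] }
  toFun :=
    { toFun := fun f => MemLp.toLp (fun x : ℝ => (x : ℂ) * (f : Lp ℂ 2 μ) x) f.2
      map_add' := by
        intro f g
        rw [← MemLp.toLp_add]
        refine MemLp.toLp_congr _ _ ?_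
        filter_upwards [Lp.coeFn_add (f : Lp ℂ 2 μ) (g : Lp ℂ 2 μ)] with x hx
        have hx' := congrArg (fun w : ℂ => (x : ℂ) * w) hx
        simpa only [Pi.add_apply, mul_add, Submodule.coe_add] using hx'
      map_smul' := by
        intro c f
        rw [RingHom.id_apply, ← MemLp.toLp_const_smul]
        refine MemLp.toLp_congr _ _ ?_
        filter_upwards [Lp.coeFn_smul c (f : Lp ℂ 2 μ)] with x hx
        simp [hx, mul_left_comm] }

/-- The functions `f ∈ L²(ℝ; μ)` with `∫ f dμ = 0`. (If `∫ dμ(x) / (1 + x²)` is finite, every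
element of `Dom (modelB μ)` is integrable.) -/
def zeroIntegral (μ : Measure ℝ) : Submodule ℂ (Lp ℂ 2 μ) where
  carrier := {f | Integrable f μ ∧ ∫ x, f x ∂μ = 0}
  zero_mem' := by
    refine ⟨(integrable_zero ℝ ℂ μ).congr (Lp.coeFn_zero ℂ 2 μ).symm, ?_⟩
    rw [integral_congr_ae (Lp.coeFn_zero ℂ 2 μ)]
    simp
  add_mem' := by
    rintro f g ⟨hf, hf0⟩ ⟨hg, hg0⟩
    refine ⟨(hf.add hg).congr (Lp.coeFn_add f g).symm, ?_⟩
    rw [integral_congr_ae (Lp.coeFn_add f g)]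
    simp [integral_add hf hg, hf0, hg0]
  smul_mem' := by
    rintro c f ⟨hf, hf0⟩
    refine ⟨(hf.smul c).congr (Lp.coeFn_smul c f).symm, ?_⟩
    rw [integral_congr_ae (Lp.coeFn_smul c f)]
    simp [integral_const_mul, hf0]

/-- The symmetric restriction of `modelB μ` to the functions with `∫ f dμ = 0`. -/
def modelBdot (μ : Measure ℝ) : Lp ℂ 2 μ →ₗ.[ℂ] Lp ℂ 2 μ :=
  (modelB μ).domRestrict (zeroIntegral μ)

/-- The dissipative quasi-self-adjoint extension of `modelBdot μ`: the restriction of the adjoint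
of `modelBdot μ` to `Dom (modelBdot μ) + span {1 / (x - i) - κ / (x + i)}`. -/
def modelBhat (μ : Measure ℝ) (κ : ℂ) : Lp ℂ 2 μ →ₗ.[ℂ] Lp ℂ 2 μ :=
  (modelBdot μ).adjoint.domRestrict
    ((modelBdot μ).domain ⊔
      Submodule.span ℂ {f : Lp ℂ 2 μ |
        f =ᵐ[μ] fun x : ℝ => 1 / ((x : ℂ) - I) - κ * (1 / ((x : ℂ) + I))})

end

/-! The pairs `(g, h)` in the graph of the adjoint of `modelBdot μ` are exactly those with `h = x g
- c`. On them `Γ₀ = c` and `Γ₁ = ∫ (g - c x / (1 + x²)) dμ` form a boundary triple. The symmetric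
operator is `Γ₀ = Γ₁ = 0`, the dissipative one is `Γ₁ = m Γ₀` with `m = i (1 + κ) / (1 - κ)` and `Im
m > 0`, and the deficiency vector `1 / (x - z)` has boundary values `1` and `M(z)`. Since `s = (M -
i) / (M + i)`, substitution gives `S = -((1 - κ) / (1 - conj κ)) (M - m) / (M - conj m)`.

On the operator side, regularity of `0` makes every extension with nonreal `m` boundedly invertible
(`IsBoundaryTriple.exists_inverse`). If `T` is the inverse for `m`, then `T^*` is the inverse for
`conj m`, and Green's identity gives `T^* - T = 2i Im m (·, φ) φ`, where `φ` represents `h ↦ Γ₀ (T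
h, h)`. The trace in the Livšic function of `-T` thus reduces to one resolvent matrix element at
`φ`. The vector `v` obtained by applying that resolvent to `φ` is a multiple of the deficiency
vector at `z`, and comparing boundary values gives `(M - m) / (M - conj m) = ω L(-1/z)` with `L` the
Livšic function of `-T` and `ω ≠ 0` constant (`IsBoundaryTriple.exists_inverse_livsic`).

Hence `S(z)` is a nonzero constant times `L(-1/z)`. As `L → 1` at infinity, that constant is the
boundary value of `S` at `0`. -/

/-! ### Abstract boundary triples and invertible extensions -/

section BoundaryTriples

variable {H : Type*} [NormedAddCommGroup H] [InnerProductSpace ℂ H]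

/-- A boundary triple with one-dimensional boundary space for the closed relation `G`, the adjoint
of the symmetric relation `{u ∈ G | Γ₀ u = Γ₁ u = 0}`. -/
structure IsBoundaryTriple (G : Submodule ℂ (H × H)) (Γ₀ Γ₁ : H × H →L[ℂ] ℂ) : Prop where
  isClosed : IsClosed (G : Set (H × H))
  green : ∀ u ∈ G, ∀ v ∈ G, inner ℂ u.1 v.2 - inner ℂ u.2 v.1 =
    (starRingEnd ℂ) (Γ₀ u) * Γ₁ v - (starRingEnd ℂ) (Γ₁ u) * Γ₀ v
  surjective : ∀ a b : ℂ, ∃ u ∈ G, Γ₀ u = a ∧ Γ₁ u = b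
  maximal : ∀ g h : H, (∀ u ∈ G, Γ₀ u = 0 → Γ₁ u = 0 → inner ℂ h u.1 = inner ℂ g u.2) →
    (g, h) ∈ G

namespace IsBoundaryTriple

variable {G : Submodule ℂ (H × H)} {Γ₀ Γ₁ : H × H →L[ℂ] ℂ}

/-- An element of `G` with a nonreal boundary condition and `Im (u.1, u.2) = 0` has vanishing
boundary values. -/
theorem boundary_eq_zero (hG : IsBoundaryTriple G Γ₀ Γ₁) {m : ℂ} (hm : m.im ≠ 0) {u : H × H}
    (hu : u ∈ G) (hum : Γ₁ u = m * Γ₀ u) (h0 : inner ℂ u.1 u.2 = inner ℂ u.2 u.1) :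
    Γ₀ u = 0 ∧ Γ₁ u = 0 := by
  -- Green's identity for `u` with itself reduces to `2i Im m |Γ₀ u|² = 0`.
  have h := hG.green u hu u hu
  rw [h0, sub_self, hum, map_mul] at h
  have h1 : (m - (starRingEnd ℂ) m) * (Γ₀ u * (starRingEnd ℂ) (Γ₀ u)) = 0 := by
    linear_combination -h
  rw [Complex.sub_conj, Complex.mul_conj] at h1
  have h2 : Γ₀ u = 0 := by simpa [hm] using h1
  exact ⟨h2, by rw [hum, h2, mul_zero]⟩

/-- If `0` is a point of regular type of the symmetric operator, every extension given by a nonreal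
boundary condition `Γ₁ = m Γ₀` has a bounded, everywhere defined inverse. -/
theorem exists_inverse [CompleteSpace H] (hG : IsBoundaryTriple G Γ₀ Γ₁) {k : ℝ} (hk : 0 < k)
    (hreg : ∀ u ∈ G, Γ₀ u = 0 → Γ₁ u = 0 → k * ‖u.1‖ ≤ ‖u.2‖) {m : ℂ} (hm : m.im ≠ 0) :
    ∃ T : H →L[ℂ] H, ∀ g h : H, ((g, h) ∈ G ∧ Γ₁ (g, h) = m * Γ₀ (g, h)) ↔ T h = g := by
  have hreg0 : ∀ u ∈ G, Γ₀ u = 0 → Γ₁ u = 0 → u.2 = 0 → u = 0 := by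
    intro u hu h0 h1 h2
    have h3 := hreg u hu h0 h1
    rw [h2, norm_zero] at h3
    have h4 : ‖u.1‖ = 0 := le_antisymm (nonpos_of_mul_nonpos_right h3 hk) (norm_nonneg _)
    exact Prod.ext (norm_eq_zero.1 h4) h2
  let G' : Submodule ℂ (H × H) := G ⊓ (LinearMap.ker (Γ₁ - m • Γ₀ : H × H →L[ℂ] ℂ).toLinearMap)
  have memG' : ∀ u, u ∈ G' ↔ u ∈ G ∧ Γ₁ u = m * Γ₀ u := by
    intro u
    simp [G', sub_eq_zero]
  let D : Submodule ℂ (H × H) := G' ⊓ LinearMap.ker Γ₀.toLinearMap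
  have memD : ∀ u, u ∈ D ↔ u ∈ G ∧ Γ₀ u = 0 ∧ Γ₁ u = 0 := by
    intro u
    simp only [D, Submodule.mem_inf, memG', LinearMap.mem_ker, ContinuousLinearMap.coe_coe]
    constructor
    · rintro ⟨⟨h1, h2⟩, h3⟩
      exact ⟨h1, h3, by rw [h2, h3, mul_zero]⟩
    · rintro ⟨h1, h2, h3⟩
      exact ⟨⟨h1, by rw [h2, h3, mul_zero]⟩, h2⟩
  have clG' : IsClosed (G' : Set (H × H)) :=
    hG.isClosed.inter (ContinuousLinearMap.isClosed_ker _)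
  have clD : IsClosed (D : Set (H × H)) := clG'.inter (ContinuousLinearMap.isClosed_ker _)
  have : CompleteSpace G' := clG'.completeSpace_coe
  have : CompleteSpace D := clD.completeSpace_coe
  let L : G' →L[ℂ] H := (ContinuousLinearMap.snd ℂ H H).comp G'.subtypeL
  let L₀ : D →L[ℂ] H := (ContinuousLinearMap.snd ℂ H H).comp D.subtypeL
  have clL₀ : IsClosed (LinearMap.range L₀.toLinearMap : Set H) := by
    -- The norm on the product is a maximum, so both components must be bounded by the second one.
    have hanti : AntilipschitzWith (Real.toNNReal (max k⁻¹ 1)) L₀ := by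
      refine ContinuousLinearMap.antilipschitz_of_bound L₀ fun u => ?_
      obtain ⟨h1, h2, h3⟩ := (memD u).1 u.2
      have h4 := hreg _ h1 h2 h3
      have h5 : ‖(u : H × H).1‖ ≤ k⁻¹ * ‖(u : H × H).2‖ := by
        rw [inv_mul_eq_div, le_div_iff₀ hk, mul_comm]; exact h4
      rw [Real.coe_toNNReal _ (le_max_of_le_right zero_le_one)]
      change max ‖(u : H × H).1‖ ‖(u : H × H).2‖ ≤ _ * ‖(u : H × H).2‖
      refine max_le (h5.trans ?_) ?_
      · gcongr
        exact le_max_left _ _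
      · calc ‖(u : H × H).2‖ = 1 * ‖(u : H × H).2‖ := (one_mul _).symm
          _ ≤ _ := by gcongr; exact le_max_right _ _
    rw [LinearMap.coe_range]
    exact hanti.isClosed_range L₀.uniformContinuous
  -- Modulo the symmetric part `D`, the extension `G'` is spanned by one element `e` with boundary
  -- values `(1, m)`. Its range is therefore a closed subspace plus a line, hence closed.
  obtain ⟨e, heG, he0, he1⟩ := hG.surjective 1 m
  have heG' : e ∈ G' := (memG' e).2 ⟨heG, by rw [he0, he1, mul_one]⟩
  have hrange : LinearMap.range L.toLinearMap =
      LinearMap.range L₀.toLinearMap ⊔ Submodule.span ℂ {e.2} := by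
    apply le_antisymm
    · rintro _ ⟨u, rfl⟩
      obtain ⟨h1, h2⟩ := (memG' u).1 u.2
      have hd : (u : H × H) - Γ₀ u • e ∈ D := by
        rw [memD]
        refine ⟨G.sub_mem h1 (G.smul_mem _ heG), ?_, ?_⟩
        · simp [he0]
        · simp [he1, h2, mul_comm]
      refine Submodule.mem_sup.2 ⟨_, ⟨⟨_, hd⟩, rfl⟩, Γ₀ u • e.2,
        Submodule.smul_mem _ _ (Submodule.mem_span_singleton_self _), ?_⟩
      simp [L, L₀]
    · refine sup_le ?_ ?_
      · rintro _ ⟨u, rfl⟩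
        exact ⟨⟨u, u.2.1⟩, rfl⟩
      · rw [Submodule.span_singleton_le_iff_mem]
        exact ⟨⟨e, heG'⟩, rfl⟩
  have clL : IsClosed (LinearMap.range L.toLinearMap : Set H) := by
    rw [hrange]
    exact Submodule.isClosed_sup_finiteDimensional _ _ clL₀
  have hinj : LinearMap.ker L.toLinearMap = ⊥ := by
    rw [LinearMap.ker_eq_bot']
    intro u hu
    have hu2 : (u : H × H).2 = 0 := hu
    obtain ⟨h1, h2⟩ := (memG' u).1 u.2
    obtain ⟨h3, h4⟩ := hG.boundary_eq_zero hm h1 h2 (by simp [hu2])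
    exact Subtype.ext (hreg0 _ h1 h3 h4 hu2)
  have hsurj : LinearMap.range L.toLinearMap = ⊤ := by
    have : CompleteSpace (LinearMap.range L.toLinearMap) := clL.completeSpace_coe
    -- A vector `p` orthogonal to the range gives `(p, 0) ∈ G` by maximality. Green's identity
    -- against `e` forces the condition `Γ₁ = conj m Γ₀` on it, so its boundary values vanish and
    -- regularity at `0` gives `p = 0`.
    rw [← Submodule.orthogonal_eq_bot_iff, Submodule.eq_bot_iff]
    intro p hp
    rw [Submodule.mem_orthogonal'] at hp
    have hp' : ∀ u ∈ G, Γ₁ u = m * Γ₀ u → inner ℂ p u.2 = 0 := fun u hu h =>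
      hp u.2 ⟨⟨u, (memG' u).2 ⟨hu, h⟩⟩, rfl⟩
    have hpG : (p, (0 : H)) ∈ G := hG.maximal p 0 fun u hu h0 h1 => by
      rw [inner_zero_left, hp' u hu (by rw [h0, h1, mul_zero])]
    have h := hG.green _ hpG e heG
    rw [inner_zero_left, hp' e heG (by rw [he0, he1, mul_one]), he0, he1] at h
    have h' : Γ₁ (p, (0 : H)) = (starRingEnd ℂ) m * Γ₀ (p, (0 : H)) := by
      have := congrArg (starRingEnd ℂ) h
      simp only [map_sub, map_mul, Complex.conj_conj, map_zero, map_one] at this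
      linear_combination this
    obtain ⟨h3, h4⟩ := hG.boundary_eq_zero (m := (starRingEnd ℂ) m) (by simpa using hm) hpG h'
      (by simp)
    exact congrArg Prod.fst (hreg0 _ hpG h3 h4 rfl)
  -- The open mapping theorem on the closed relation `G'` bounds the inverse; `T` is its first
  -- component.
  let E := ContinuousLinearEquiv.ofBijective L hinj hsurj
  have hE : ∀ u : G', E u = (u : H × H).2 := fun u => rfl
  refine ⟨(ContinuousLinearMap.fst ℂ H H).comp (G'.subtypeL.comp (E.symm : H →L[ℂ] G')), ?_⟩
  intro g h
  change _ ↔ ((E.symm h : G') : H × H).1 = g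
  constructor
  · intro hgh
    have : E.symm h = ⟨(g, h), (memG' _).2 hgh⟩ := by
      rw [ContinuousLinearEquiv.symm_apply_eq, hE]
    rw [this]
  · intro hgh
    have h2 : ((E.symm h : G') : H × H).2 = h := by rw [← hE, E.apply_symm_apply]
    have h3 : ((E.symm h : G') : H × H) = (g, h) := Prod.ext hgh h2
    exact (memG' _).1 (h3 ▸ (E.symm h).2)

end IsBoundaryTriple

/-! ### Operators with rank-one imaginary part -/

/-- The trace of a rank-one operator. -/
theorem finiteRankTrace_eq_inner {F : H →L[ℂ] H} {φ ψ : H} (hφ : φ ≠ 0)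
    (hF : ∀ x, F x = inner ℂ φ x • ψ) : finiteRankTrace F = inner ℂ φ ψ := by
  have hle : LinearMap.range (F : H →ₗ[ℂ] H) ≤ Submodule.span ℂ {ψ} := by
    rintro _ ⟨x, rfl⟩
    exact Submodule.mem_span_singleton.2 ⟨_, (hF x).symm⟩
  have : FiniteDimensional ℂ (LinearMap.range (F : H →ₗ[ℂ] H)) :=
    Submodule.finiteDimensional_of_le hle
  -- `φ ≠ 0` places `ψ` in the range, so that `F` on its range factors through `ℂ` and the trace can
  -- be computed by cyclicity.
  have hψ : ψ ∈ LinearMap.range (F : H →ₗ[ℂ] H) := by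
    refine ⟨(inner ℂ φ φ)⁻¹ • φ, ?_⟩
    rw [ContinuousLinearMap.coe_coe, hF, inner_smul_right,
      inv_mul_cancel₀ (inner_self_ne_zero.2 hφ), one_smul]
  let a : ℂ →ₗ[ℂ] LinearMap.range (F : H →ₗ[ℂ] H) := LinearMap.toSpanSingleton ℂ _ ⟨ψ, hψ⟩
  let b : LinearMap.range (F : H →ₗ[ℂ] H) →ₗ[ℂ] ℂ :=
    (innerSL ℂ φ).toLinearMap ∘ₗ (LinearMap.range (F : H →ₗ[ℂ] H)).subtype
  have hab : (F : H →ₗ[ℂ] H).rangeRestrict ∘ₗ (LinearMap.range (F : H →ₗ[ℂ] H)).subtype =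
      a ∘ₗ b := by
    ext x
    simp [a, b, hF]
  have hba : b ∘ₗ a = inner ℂ φ ψ • LinearMap.id := by
    ext
    simp [a, b]
  rw [finiteRankTrace, hab, LinearMap.trace_comp_comm', hba, map_smul, LinearMap.trace_id,
    Module.finrank_self, Nat.cast_one, smul_eq_mul, mul_one]

theorem ringInverse_neg {R : Type*} [Ring R] (a : R) : Ring.inverse (-a) = -Ring.inverse a := by
  by_cases ha : IsUnit a
  · obtain ⟨u, rfl⟩ := ha
    rw [← Units.val_neg, Ring.inverse_unit, Ring.inverse_unit, inv_neg, Units.val_neg]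
  · rw [Ring.inverse_non_unit _ ha, Ring.inverse_non_unit _ (by rwa [IsUnit.neg_iff]), neg_zero]

section RankOneImaginaryPart

variable [CompleteSpace H] {T : H →L[ℂ] H} {c : ℝ} {φ : H}

/-- If `T^* - T = 2ic (·, φ) φ`, then `Im (-T) = c (·, φ) φ`. -/
theorem imaginaryPart_neg_apply
    (hT : ∀ x, ContinuousLinearMap.adjoint T x - T x = (2 * I * c) • (inner ℂ φ x • φ)) (x : H) :
    (ℑ (-T) : H →L[ℂ] H) x = (c : ℂ) • (inner ℂ φ x • φ) := by
  have h : (ℑ (-T) : H →L[ℂ] H) x =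
      (-I) • ((2 : ℝ)⁻¹ • (ContinuousLinearMap.adjoint T x - T x)) := by
    rw [imaginaryPart_apply_coe, ← ContinuousLinearMap.star_eq_adjoint]
    simp only [smul_apply, sub_apply, star_neg,
      neg_apply]
    congr 2
    abel
  rw [h, hT, ← Complex.coe_smul (2 : ℝ)⁻¹, smul_smul, smul_smul]
  congr 1
  push_cast
  linear_combination (-c : ℂ) * Complex.I_sq

theorem isBoundedDissipative_neg_of_rankOne
    (hT : ∀ x, ContinuousLinearMap.adjoint T x - T x = (2 * I * c) • (inner ℂ φ x • φ))
    (hc : 0 ≤ c) : IsBoundedDissipative (-T) := by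
  intro f
  have h := congrArg (fun y => inner ℂ f y) (hT f)
  simp only [inner_sub_right, ContinuousLinearMap.adjoint_inner_right, inner_smul_right] at h
  rw [← inner_conj_symm (T f), ← inner_conj_symm f φ] at h
  have h2 := congrArg Complex.im h
  rw [Complex.mul_conj, Complex.sub_im, Complex.conj_im] at h2
  simp only [mul_im, mul_re, re_ofNat, im_ofNat, I_re, I_im, ofReal_re, ofReal_im] at h2
  rw [neg_apply, inner_neg_right, Complex.neg_im]
  nlinarith [mul_nonneg hc (Complex.normSq_nonneg (inner ℂ φ f))]

theorem finrank_range_imaginaryPart_neg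
    (hT : ∀ x, ContinuousLinearMap.adjoint T x - T x = (2 * I * c) • (inner ℂ φ x • φ))
    (hc : c ≠ 0) (hφ : φ ≠ 0) :
    Module.finrank ℂ (LinearMap.range ((ℑ (-T) : H →L[ℂ] H) : H →ₗ[ℂ] H)) = 1 := by
  have h : LinearMap.range ((ℑ (-T) : H →L[ℂ] H) : H →ₗ[ℂ] H) = Submodule.span ℂ {φ} := by
    apply le_antisymm
    · rintro _ ⟨x, rfl⟩
      rw [ContinuousLinearMap.coe_coe, imaginaryPart_neg_apply hT, smul_smul]
      exact Submodule.smul_mem _ _ (Submodule.mem_span_singleton_self _)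
    · rw [Submodule.span_singleton_le_iff_mem]
      refine ⟨((c : ℂ) * inner ℂ φ φ)⁻¹ • φ, ?_⟩
      have hne : (c : ℂ) * inner ℂ φ φ ≠ 0 :=
        mul_ne_zero (by exact_mod_cast hc) (inner_self_ne_zero.2 hφ)
      rw [map_smul, ContinuousLinearMap.coe_coe, imaginaryPart_neg_apply hT, smul_smul, smul_smul,
        mul_assoc, inv_mul_cancel₀ hne, one_smul]
  rw [h, finrank_span_singleton hφ]

theorem livsicCharacteristicFunction_neg
    (hT : ∀ x, ContinuousLinearMap.adjoint T x - T x = (2 * I * c) • (inner ℂ φ x • φ))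
    (hφ : φ ≠ 0) (w : ℂ) :
    livsicCharacteristicFunction (-T) w = 1 + 2 * I * c *
      inner ℂ φ (Ring.inverse (ContinuousLinearMap.adjoint (-T) - w • (1 : H →L[ℂ] H)) φ) := by
  rw [livsicCharacteristicFunction, finiteRankTrace_eq_inner (φ := φ)
    (ψ := (c : ℂ) • Ring.inverse (ContinuousLinearMap.adjoint (-T) - w • (1 : H →L[ℂ] H)) φ) hφ,
    inner_smul_right]
  · ring
  · intro x
    rw [mul_apply_eq_comp, imaginaryPart_neg_apply hT, map_smul, map_smul,
      smul_comm]

/-- The resolvent of a bounded operator vanishes at infinity. This later identifies the boundary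
value of `S` at `0`. -/
theorem tendsto_livsicCharacteristicFunction_neg
    (hT : ∀ x, ContinuousLinearMap.adjoint T x - T x = (2 * I * c) • (inner ℂ φ x • φ))
    (hφ : φ ≠ 0) :
    Filter.Tendsto (livsicCharacteristicFunction (-T)) (Bornology.cobounded ℂ) (nhds 1) := by
  have h1 : ∀ w : ℂ, Ring.inverse (ContinuousLinearMap.adjoint (-T) - w • (1 : H →L[ℂ] H)) =
      -resolvent (ContinuousLinearMap.adjoint (-T)) w := by
    intro w
    rw [resolvent, ← ringInverse_neg, neg_sub, Algebra.algebraMap_eq_smul_one]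
  have h2 : Filter.Tendsto (fun w : ℂ => 1 + 2 * I * c *
      inner ℂ φ ((-resolvent (ContinuousLinearMap.adjoint (-T)) w) φ))
      (Bornology.cobounded ℂ) (nhds (1 + 2 * I * c * inner ℂ φ ((-(0 : H →L[ℂ] H)) φ))) := by
    refine Filter.Tendsto.const_add _ (Filter.Tendsto.const_mul _ ?_)
    have hcont : Continuous fun A : H →L[ℂ] H => inner ℂ φ ((-A) φ) := by fun_prop
    exact (hcont.tendsto 0).comp
      (spectrum.resolvent_tendsto_cobounded (𝕜 := ℂ) (ContinuousLinearMap.adjoint (-T)))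
  simp only [neg_zero, zero_apply, inner_zero_right, mul_zero, add_zero] at h2
  refine h2.congr fun w => ?_
  rw [livsicCharacteristicFunction_neg hT hφ, h1]

/-- The adjoint of a bounded dissipative operator has no spectrum in the upper half-plane. -/
theorem IsBoundedDissipative.isUnit_adjoint_sub {A : H →L[ℂ] H} (hA : IsBoundedDissipative A)
    {w : ℂ} (hw : 0 < w.im) :
    IsUnit (ContinuousLinearMap.adjoint A - w • (1 : H →L[ℂ] H)) := by
  -- Numerical range bound: `Im ((A^* - w) x, x)`, in the order of `inner`, equals `Im (inner ℂ x (A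
  -- x)) + Im w ‖x‖²`, which is at least `Im w ‖x‖²`.
  refine ContinuousLinearMap.isUnit_of_forall_le_norm_inner_map _ (c := ⟨w.im, hw.le⟩)
    (by exact_mod_cast hw) fun x => ?_
  have h1 : inner ℂ ((ContinuousLinearMap.adjoint A - w • (1 : H →L[ℂ] H)) x) x =
      inner ℂ x (A x) - (starRingEnd ℂ) w * (‖x‖ : ℂ) ^ 2 := by
    simp [ContinuousLinearMap.adjoint_inner_left, inner_self_eq_norm_sq_to_K, mul_comm]
  rw [h1]
  refine le_trans ?_ (Complex.abs_im_le_norm _)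
  refine le_trans ?_ (le_abs_self _)
  have h2 := hA x
  rw [← Complex.ofReal_pow]
  simp only [Complex.sub_im, Complex.im_mul_ofReal, Complex.conj_im]
  change ‖x‖ ^ 2 * w.im ≤ _
  nlinarith

end RankOneImaginaryPart

/-! ### The Livšic function of an inverse and the Weyl function -/

/-- For the inverse `T` of a dissipative extension `Γ₁ = m Γ₀`, the Livšic function of `-T` is,
up to a constant factor, the Cayley-type transform `(M - m) / (M - conj m)` of the Weyl
function `M`. -/
theorem IsBoundaryTriple.exists_inverse_livsic [CompleteSpace H] {G : Submodule ℂ (H × H)}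
    {Γ₀ Γ₁ : H × H →L[ℂ] ℂ} (hG : IsBoundaryTriple G Γ₀ Γ₁) {k : ℝ} (hk : 0 < k)
    (hreg : ∀ u ∈ G, Γ₀ u = 0 → Γ₁ u = 0 → k * ‖u.1‖ ≤ ‖u.2‖) {m : ℂ} (hm : 0 < m.im) :
    ∃ (T : H →L[ℂ] H) (ω : ℂ),
      (∀ g h : H, ((g, h) ∈ G ∧ Γ₁ (g, h) = m * Γ₀ (g, h)) ↔ T h = g) ∧
      IsBoundedDissipative (-T) ∧
      Module.finrank ℂ (LinearMap.range ((ℑ (-T) : H →L[ℂ] H) : H →ₗ[ℂ] H)) = 1 ∧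
      Filter.Tendsto (livsicCharacteristicFunction (-T)) (Bornology.cobounded ℂ) (nhds 1) ∧
      ω ≠ 0 ∧ ∀ (z : ℂ) (g : H), 0 < z.im → (g, z • g) ∈ G → Γ₀ (g, z • g) = 1 →
        Γ₁ (g, z • g) - m = (Γ₁ (g, z • g) - (starRingEnd ℂ) m) *
          (ω * livsicCharacteristicFunction (-T) (-1 / z)) := by
  obtain ⟨T, hT⟩ := hG.exists_inverse hk hreg hm.ne'
  obtain ⟨T', hT'⟩ := hG.exists_inverse hk hreg (m := (starRingEnd ℂ) m)
    (by simpa using hm.ne')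
  have T_mem : ∀ h, (T h, h) ∈ G := fun h => ((hT _ _).2 rfl).1
  have T_bd : ∀ h, Γ₁ (T h, h) = m * Γ₀ (T h, h) := fun h => ((hT _ _).2 rfl).2
  have T'_mem : ∀ h, (T' h, h) ∈ G := fun h => ((hT' _ _).2 rfl).1
  have T'_bd : ∀ h, Γ₁ (T' h, h) = (starRingEnd ℂ) m * Γ₀ (T' h, h) :=
    fun h => ((hT' _ _).2 rfl).2
  -- For conditions `conj m` and `m` the boundary form in Green's identity cancels.
  have hadj : ContinuousLinearMap.adjoint T = T' := by
    symm
    rw [ContinuousLinearMap.eq_adjoint_iff]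
    intro x y
    have h := hG.green _ (T'_mem x) _ (T_mem y)
    rw [T_bd, T'_bd, map_mul, Complex.conj_conj] at h
    have h' : inner ℂ (T' x) y - inner ℂ x (T y) = 0 := by rw [h]; ring
    exact sub_eq_zero.1 h'
  let τ : H →L[ℂ] ℂ := Γ₀.comp (T.prod (ContinuousLinearMap.id ℂ H))
  have hτ : ∀ h, τ h = Γ₀ (T h, h) := fun h => rfl
  let φ : H := (InnerProductSpace.toDual ℂ H).symm τ
  have hφ : ∀ h, inner ℂ φ h = Γ₀ (T h, h) := fun h => by
    rw [InnerProductSpace.toDual_symm_apply, hτ]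
  have hmc : m - (starRingEnd ℂ) m = 2 * I * m.im := by
    rw [Complex.sub_conj]; push_cast; ring
  have hmc0 : (2 * I * (m.im : ℂ)) ≠ 0 := by simp [hm.ne']
  have hrank : ∀ x, ContinuousLinearMap.adjoint T x - T x =
      (2 * I * (m.im : ℂ)) • (inner ℂ φ x • φ) := by
    intro x
    refine ext_inner_left ℂ fun y => ?_
    rw [inner_sub_right, ContinuousLinearMap.adjoint_inner_right, inner_smul_right,
      inner_smul_right, ← inner_conj_symm y φ, hφ, hφ, ← hmc]
    have h := hG.green _ (T_mem y) _ (T_mem x)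
    rw [T_bd, T_bd, map_mul] at h
    simp only at h
    rw [h]
    ring
  have hF : ∀ h, ((T' h, h) : H × H) - (T h, h) =
      (2 * I * (m.im : ℂ) * Γ₀ (T h, h)) • ((φ, 0) : H × H) := by
    intro h
    have := hrank h
    rw [hadj, hφ, smul_smul] at this
    ext
    · simpa using this
    · simp
  have hF0 : ∀ h, Γ₀ (T' h, h) - Γ₀ (T h, h) =
      2 * I * (m.im : ℂ) * Γ₀ (T h, h) * Γ₀ (φ, 0) := fun h => by
    rw [← map_sub, hF, map_smul, smul_eq_mul]
  have hF1 : ∀ h, (starRingEnd ℂ) m * Γ₀ (T' h, h) - m * Γ₀ (T h, h) =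
      2 * I * (m.im : ℂ) * Γ₀ (T h, h) * Γ₁ (φ, 0) := fun h => by
    rw [← T_bd, ← T'_bd, ← map_sub, hF, map_smul, smul_eq_mul]
  obtain ⟨e, heG, he0, he1⟩ := hG.surjective 1 m
  have he : Γ₀ (T e.2, e.2) = 1 := by
    rw [(hT e.1 e.2).1 ⟨heG, by rw [he0, he1, mul_one]⟩, he0]
  obtain ⟨e', heG', he0', he1'⟩ := hG.surjective 1 ((starRingEnd ℂ) m)
  have he' : Γ₀ (T' e'.2, e'.2) = 1 := by
    rw [(hT' e'.1 e'.2).1 ⟨heG', by rw [he0', he1', mul_one]⟩, he0']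
  have hφ0 : φ ≠ 0 := by
    intro h
    have := hφ e.2
    rw [h, inner_zero_left, he] at this
    exact zero_ne_one this
  -- Apply `Γ₁ - conj m Γ₀` to `hF`: the term of `T'` drops out. Applying `Γ₁ - m Γ₀` instead
  -- removes the term of `T` and gives `hτ'`, whose factor is `ω`.
  have hφbd : Γ₁ (φ, 0) - (starRingEnd ℂ) m * Γ₀ (φ, 0) = -1 := by
    have h0 := hF0 e.2
    have h1 := hF1 e.2
    rw [he] at h0 h1
    apply mul_left_cancel₀ hmc0
    linear_combination (starRingEnd ℂ) m * h0 - h1 - hmc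
  have hτ' : ∀ h, Γ₀ (T' h, h) = -(Γ₁ (φ, 0) - m * Γ₀ (φ, 0)) * Γ₀ (T h, h) := by
    intro h
    apply mul_left_cancel₀ hmc0
    linear_combination m * hF0 h - hF1 h - Γ₀ (T' h, h) * hmc
  have hφG : ((φ, 0) : H × H) ∈ G := by
    have h := G.sub_mem (T'_mem e.2) (T_mem e.2)
    rw [hF] at h
    exact (G.smul_mem_iff (by rw [he, mul_one]; exact hmc0)).1 h
  have hdiss := isBoundedDissipative_neg_of_rankOne hrank hm.le
  refine ⟨T, -(Γ₁ (φ, 0) - m * Γ₀ (φ, 0)), hT, hdiss,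
    finrank_range_imaginaryPart_neg hrank hm.ne' hφ0,
    tendsto_livsicCharacteristicFunction_neg hrank hφ0, ?_, ?_⟩
  -- If `ω` were `0`, `Γ₀` would vanish on the whole extension with parameter `conj m`, against the
  -- choice of `e'`.
  · intro h
    have := hτ' e'.2
    rw [h, he', zero_mul] at this
    exact one_ne_zero this
  intro z g hz hgG hg0
  have hz0 : z ≠ 0 := by rintro rfl; simp at hz
  have hw : 0 < (-1 / z).im := by
    rw [neg_div, one_div, Complex.neg_im, Complex.inv_im, neg_div, neg_neg]
    exact div_pos hz (Complex.normSq_pos.2 hz0)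
  have hunit := hdiss.isUnit_adjoint_sub hw
  rw [livsicCharacteristicFunction_neg hrank hφ0]
  set v : H := Ring.inverse (ContinuousLinearMap.adjoint (-T) - (-1 / z) • (1 : H →L[ℂ] H)) φ
    with hv
  have hv' : -T' v + z⁻¹ • v = φ := by
    have h : ((ContinuousLinearMap.adjoint (-T) - (-1 / z) • (1 : H →L[ℂ] H)) *
        Ring.inverse (ContinuousLinearMap.adjoint (-T) - (-1 / z) • (1 : H →L[ℂ] H))) φ = φ := by
      rw [Ring.mul_inverse_cancel _ hunit, one_apply_eq_self]
    rw [mul_apply_eq_comp, ← hv, map_neg, hadj] at h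
    simpa [neg_div, sub_eq_add_neg] using h
  -- The resolvent equation for `v` says that this pair lies in `G`; its second entry is `z` times
  -- the first.
  have hpair : ((z⁻¹ • v, v) : H × H) = (φ, 0) + (T' v, v) := by
    ext
    · simp [← hv']
    · simp
  have hvG : ((z⁻¹ • v, v) : H × H) ∈ G := by
    rw [hpair]; exact G.add_mem hφG (T'_mem v)
  have hv0 : Γ₀ (z⁻¹ • v, v) = Γ₀ (φ, 0) + Γ₀ (T' v, v) := by rw [hpair, map_add]
  have hv1 : Γ₁ (z⁻¹ • v, v) = Γ₁ (φ, 0) + (starRingEnd ℂ) m * Γ₀ (T' v, v) := by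
    rw [hpair, map_add, T'_bd]
  set a : ℂ := Γ₀ (z⁻¹ • v, v) with ha
  have hdG : ((z⁻¹ • v, v) : H × H) - a • (g, z • g) ∈ G := G.sub_mem hvG (G.smul_mem _ hgG)
  have hd : ((z⁻¹ • v, v) : H × H) - a • (g, z • g) =
      (z⁻¹ • v - a • g, z • (z⁻¹ • v - a • g)) := by
    ext
    · simp
    · simp [smul_sub, smul_smul, hz0, mul_comm]
  have hd0 : Γ₀ (((z⁻¹ • v, v) : H × H) - a • (g, z • g)) = 0 := by
    rw [map_sub, map_smul, hg0, smul_eq_mul, mul_one, sub_self]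
  -- The difference is an eigenvector for the nonreal `z` with `Γ₀ = 0`, so Green's identity makes
  -- its norm zero.
  have hdz : z⁻¹ • v - a • g = 0 := by
    have h := hG.green _ hdG _ hdG
    rw [hd0, hd] at h
    simp only [inner_smul_left, inner_smul_right, map_zero, zero_mul, mul_zero, sub_self] at h
    rw [← sub_mul, Complex.sub_conj] at h
    simpa [hz.ne'] using h
  have hM : Γ₁ (z⁻¹ • v, v) = a * Γ₁ (g, z • g) := by
    have h := congrArg Γ₁ hd
    rw [hdz, smul_zero, Prod.mk_zero_zero, map_zero, map_sub, map_smul, smul_eq_mul] at h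
    exact sub_eq_zero.1 h
  set M := Γ₁ (g, z • g)
  -- The combinations `Γ₁ - conj m Γ₀` and `Γ₁ - m Γ₀` of the pair give `a (M - conj m) = -1` and `a
  -- (M - m) = -ω L`; dividing by `a` yields the formula.
  have e1 : a * (M - (starRingEnd ℂ) m) = -1 := by
    linear_combination hφbd - hM + hv1 - (starRingEnd ℂ) m * hv0
  have e2 : a * (M - m) = (Γ₁ (φ, 0) - m * Γ₀ (φ, 0)) - 2 * I * (m.im : ℂ) * Γ₀ (T' v, v) := by
    linear_combination - hM + hv1 - m * hv0 - Γ₀ (T' v, v) * hmc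
  have ha0 : a ≠ 0 := by
    intro h
    rw [h, zero_mul] at e1
    simp at e1
  apply mul_left_cancel₀ ha0
  rw [← mul_assoc a, e1, e2, hτ', hφ]
  ring

end BoundaryTriples

/-! ### Cauchy kernels in the model space -/

section Model

variable {μ : Measure ℝ}

theorem ofReal_sub_ne_zero {z : ℂ} (hz : z.im ≠ 0) (x : ℝ) : (x : ℂ) - z ≠ 0 := by
  intro h
  have := congrArg Complex.im h
  simp at this
  exact hz this

theorem ofReal_add_I_ne_zero (x : ℝ) : (x : ℂ) + I ≠ 0 := by
  have := ofReal_sub_ne_zero (z := -I) (by simp) x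
  rwa [sub_neg_eq_add] at this

theorem ofReal_sub_I_ne_zero (x : ℝ) : (x : ℂ) - I ≠ 0 :=
  ofReal_sub_ne_zero (by simp) x

theorem normSq_ofReal_sub_I (x : ℝ) : ‖(x : ℂ) - I‖ ^ 2 = 1 + x ^ 2 := by
  rw [← Complex.normSq_eq_norm_sq, Complex.normSq_apply]
  simp
  ring

theorem integrable_one_div_one_add_sq
    (hμ : ∫⁻ x : ℝ, ENNReal.ofReal (1 / (1 + x ^ 2)) ∂μ = 1) :
    Integrable (fun x : ℝ => 1 / (1 + x ^ 2)) μ := by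
  refine ⟨Measurable.aestronglyMeasurable (by fun_prop), ?_⟩
  rw [hasFiniteIntegral_iff_ofReal (Filter.Eventually.of_forall fun x => by positivity), hμ]
  exact ENNReal.one_lt_top

theorem integral_one_div_one_add_sq_eq_one
    (hμ : ∫⁻ x : ℝ, ENNReal.ofReal (1 / (1 + x ^ 2)) ∂μ = 1) :
    ∫ x : ℝ, 1 / (1 + x ^ 2) ∂μ = 1 := by
  rw [integral_eq_lintegral_of_nonneg_ae (Filter.Eventually.of_forall fun x => by positivity)
    (Measurable.aestronglyMeasurable (by fun_prop)), hμ, ENNReal.toReal_one]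

/-- The Cauchy kernels `1 / (x - z)` with nonreal `z` are square integrable. -/
theorem memLp_cauchyKernel (hμ : ∫⁻ x : ℝ, ENNReal.ofReal (1 / (1 + x ^ 2)) ∂μ = 1) {z : ℂ}
    (hz : z.im ≠ 0) : MemLp (fun x : ℝ => 1 / ((x : ℂ) - z)) 2 μ := by
  have hI : MemLp (fun x : ℝ => 1 / ((x : ℂ) - I)) 2 μ := by
    rw [memLp_two_iff_integrable_sq_norm (Measurable.aestronglyMeasurable (by fun_prop))]
    refine (integrable_one_div_one_add_sq hμ).congr (Filter.Eventually.of_forall fun x => ?_)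
    simp only [norm_div, norm_one, div_pow, one_pow, normSq_ofReal_sub_I]
  -- The constant comes from `|x - i| ≤ |x - z| + |z - i|` and `|x - z| ≥ |Im z|`.
  refine hI.of_le_mul (c := 1 + ‖z - I‖ / |z.im|)
    (Measurable.aestronglyMeasurable (by fun_prop)) (Filter.Eventually.of_forall fun x => ?_)
  have h1 : |z.im| ≤ ‖(x : ℂ) - z‖ := by
    have := Complex.abs_im_le_norm ((x : ℂ) - z)
    simpa using this
  have h2 : ‖(x : ℂ) - I‖ ≤ ‖(x : ℂ) - z‖ + ‖z - I‖ := by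
    have := norm_add_le ((x : ℂ) - z) (z - I)
    simpa using this
  have h3 : 0 < |z.im| := abs_pos.2 hz
  have h4 : 0 < ‖(x : ℂ) - I‖ := norm_pos_iff.2 (ofReal_sub_I_ne_zero x)
  have h5 : 0 < ‖(x : ℂ) - z‖ := norm_pos_iff.2 (ofReal_sub_ne_zero hz x)
  rw [norm_div, norm_div, norm_one, mul_one_div, div_le_div_iff₀ h5 h4, one_mul]
  have h6 : ‖z - I‖ ≤ ‖z - I‖ / |z.im| * ‖(x : ℂ) - z‖ := by
    rw [div_mul_eq_mul_div, le_div_iff₀ h3]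
    gcongr
  linarith

/-- The deficiency element `1 / (x - z)` of the model operator. -/
noncomputable def cauchyVector (hμ : ∫⁻ x : ℝ, ENNReal.ofReal (1 / (1 + x ^ 2)) ∂μ = 1) {z : ℂ}
    (hz : z.im ≠ 0) : Lp ℂ 2 μ :=
  (memLp_cauchyKernel hμ hz).toLp _

theorem coeFn_cauchyVector (hμ : ∫⁻ x : ℝ, ENNReal.ofReal (1 / (1 + x ^ 2)) ∂μ = 1) {z : ℂ}
    (hz : z.im ≠ 0) : cauchyVector hμ hz =ᵐ[μ] fun x : ℝ => 1 / ((x : ℂ) - z) :=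
  MemLp.coeFn_toLp _

theorem I_im_ne_zero : I.im ≠ 0 := by simp

theorem neg_I_im_ne_zero : (-I).im ≠ 0 := by simp

theorem inner_cauchyVector (hμ : ∫⁻ x : ℝ, ENNReal.ofReal (1 / (1 + x ^ 2)) ∂μ = 1) {z : ℂ}
    (hz : z.im ≠ 0) (f : Lp ℂ 2 μ) :
    Integrable (fun x : ℝ => f x / ((x : ℂ) - (starRingEnd ℂ) z)) μ ∧
      inner ℂ (cauchyVector hμ hz) f = ∫ x : ℝ, f x / ((x : ℂ) - (starRingEnd ℂ) z) ∂μ := by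
  have h : (fun x : ℝ => inner ℂ ((cauchyVector hμ hz : Lp ℂ 2 μ) x) (f x)) =ᵐ[μ]
      fun x : ℝ => f x / ((x : ℂ) - (starRingEnd ℂ) z) := by
    filter_upwards [coeFn_cauchyVector hμ hz] with x hx
    rw [hx, RCLike.inner_apply]
    simp [div_eq_mul_inv]
  exact ⟨(L2.integrable_inner _ _).congr h, by rw [L2.inner_def, integral_congr_ae h]⟩

/-- The relation `h = x g - c`, paired with a Cauchy kernel. -/
theorem inner_cauchyVector_sub (hμ : ∫⁻ x : ℝ, ENNReal.ofReal (1 / (1 + x ^ 2)) ∂μ = 1) {z : ℂ}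
    (hz : z.im ≠ 0) {g h : Lp ℂ 2 μ} {c : ℂ} (hgh : h =ᵐ[μ] fun x : ℝ => (x : ℂ) * g x - c) :
    Integrable (fun x : ℝ => g x - c / ((x : ℂ) - (starRingEnd ℂ) z)) μ ∧
      inner ℂ (cauchyVector hμ hz) (h - (starRingEnd ℂ) z • g) =
        ∫ x : ℝ, (g x - c / ((x : ℂ) - (starRingEnd ℂ) z)) ∂μ := by
  obtain ⟨h1, h2⟩ := inner_cauchyVector hμ hz (h - (starRingEnd ℂ) z • g)
  have h3 : (fun x : ℝ => (h - (starRingEnd ℂ) z • g : Lp ℂ 2 μ) x /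
      ((x : ℂ) - (starRingEnd ℂ) z)) =ᵐ[μ]
      fun x : ℝ => g x - c / ((x : ℂ) - (starRingEnd ℂ) z) := by
    filter_upwards [hgh, Lp.coeFn_sub h ((starRingEnd ℂ) z • g),
      Lp.coeFn_smul ((starRingEnd ℂ) z) g] with x e1 e2 e3
    have hne : (x : ℂ) - (starRingEnd ℂ) z ≠ 0 := ofReal_sub_ne_zero (by simpa using hz) x
    rw [e2, Pi.sub_apply, e3, Pi.smul_apply, e1, smul_eq_mul]
    field_simp
    ring
  exact ⟨h1.congr h3, by rw [h2, integral_congr_ae h3]⟩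

theorem integral_complex_one_div_one_add_sq (hμ : ∫⁻ x : ℝ, ENNReal.ofReal (1 / (1 + x ^ 2)) ∂μ = 1) :
    ∫ x : ℝ, (1 / ((1 : ℂ) + (x : ℂ) ^ 2)) ∂μ = 1 := by
  have h := integral_one_div_one_add_sq_eq_one hμ
  rw [← Complex.ofReal_inj, ← integral_complex_ofReal] at h
  simpa using h

theorem norm_cauchyVector (hμ : ∫⁻ x : ℝ, ENNReal.ofReal (1 / (1 + x ^ 2)) ∂μ = 1) {z : ℂ}
    (hz : z.im ≠ 0) (hzI : ∀ x : ℝ, ‖(x : ℂ) - z‖ ^ 2 = 1 + x ^ 2) :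
    ‖cauchyVector hμ hz‖ = 1 := by
  have h : inner ℂ (cauchyVector hμ hz) (cauchyVector hμ hz) = (1 : ℂ) := by
    rw [(inner_cauchyVector hμ hz _).2, ← integral_complex_one_div_one_add_sq hμ]
    refine integral_congr_ae ?_
    filter_upwards [coeFn_cauchyVector hμ hz] with x hx
    have h1 : ((x : ℂ) - z) * ((x : ℂ) - (starRingEnd ℂ) z) = 1 + (x : ℂ) ^ 2 := by
      have := Complex.mul_conj' ((x : ℂ) - z)
      rw [map_sub, Complex.conj_ofReal] at this
      rw [this]
      exact_mod_cast hzI x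
    rw [hx, div_div, h1]
  rw [inner_self_eq_norm_sq_to_K] at h
  have h' : ‖cauchyVector hμ hz‖ ^ 2 = 1 := by
    apply Complex.ofReal_injective
    rw [Complex.ofReal_pow, Complex.ofReal_one]
    exact h
  nlinarith [norm_nonneg (cauchyVector hμ hz)]

theorem norm_cauchyVector_I (hμ : ∫⁻ x : ℝ, ENNReal.ofReal (1 / (1 + x ^ 2)) ∂μ = 1) :
    ‖cauchyVector hμ I_im_ne_zero‖ = 1 :=
  norm_cauchyVector hμ _ normSq_ofReal_sub_I

theorem norm_cauchyVector_neg_I (hμ : ∫⁻ x : ℝ, ENNReal.ofReal (1 / (1 + x ^ 2)) ∂μ = 1) :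
    ‖cauchyVector hμ neg_I_im_ne_zero‖ = 1 :=
  norm_cauchyVector hμ _ fun x => by
    rw [← normSq_ofReal_sub_I, ← Complex.norm_conj]
    simp [sub_eq_add_neg]

/-! ### Boundary values -/

/-- The boundary value `c` of `(g, x g - c)`. -/
noncomputable def boundaryZero (hμ : ∫⁻ x : ℝ, ENNReal.ofReal (1 / (1 + x ^ 2)) ∂μ = 1) :
    Lp ℂ 2 μ × Lp ℂ 2 μ →L[ℂ] ℂ :=
  (1 / (2 * I)) •
    ((innerSL ℂ (cauchyVector hμ I_im_ne_zero)).comp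
        (ContinuousLinearMap.snd ℂ _ _ + I • ContinuousLinearMap.fst ℂ _ _) -
      (innerSL ℂ (cauchyVector hμ neg_I_im_ne_zero)).comp
        (ContinuousLinearMap.snd ℂ _ _ - I • ContinuousLinearMap.fst ℂ _ _))

/-- The boundary value `∫ (g - c x / (1 + x²)) dμ` of `(g, x g - c)`. -/
noncomputable def boundaryOne (hμ : ∫⁻ x : ℝ, ENNReal.ofReal (1 / (1 + x ^ 2)) ∂μ = 1) :
    Lp ℂ 2 μ × Lp ℂ 2 μ →L[ℂ] ℂ :=
  (1 / 2 : ℂ) •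
    ((innerSL ℂ (cauchyVector hμ I_im_ne_zero)).comp
        (ContinuousLinearMap.snd ℂ _ _ + I • ContinuousLinearMap.fst ℂ _ _) +
      (innerSL ℂ (cauchyVector hμ neg_I_im_ne_zero)).comp
        (ContinuousLinearMap.snd ℂ _ _ - I • ContinuousLinearMap.fst ℂ _ _))

theorem boundaryZero_apply (hμ : ∫⁻ x : ℝ, ENNReal.ofReal (1 / (1 + x ^ 2)) ∂μ = 1)
    (g h : Lp ℂ 2 μ) : boundaryZero hμ (g, h) = (1 / (2 * I)) *
      (inner ℂ (cauchyVector hμ I_im_ne_zero) (h + I • g) -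
        inner ℂ (cauchyVector hμ neg_I_im_ne_zero) (h - I • g)) := rfl

theorem boundaryOne_apply (hμ : ∫⁻ x : ℝ, ENNReal.ofReal (1 / (1 + x ^ 2)) ∂μ = 1)
    (g h : Lp ℂ 2 μ) : boundaryOne hμ (g, h) = (1 / 2) *
      (inner ℂ (cauchyVector hμ I_im_ne_zero) (h + I • g) +
        inner ℂ (cauchyVector hμ neg_I_im_ne_zero) (h - I • g)) := rfl

/-- With `h = x g - c`, the two inner products are the integrals of `g - c / (x + i)` and `g - c /
(x - i)`. Their difference integrates `2ic / (1 + x²)`, which is `2ic` by normalization, and their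
mean integrates `g - c x / (1 + x²)`. Inner products with fixed vectors make both functionals
continuous on all pairs. -/
theorem boundary_values (hμ : ∫⁻ x : ℝ, ENNReal.ofReal (1 / (1 + x ^ 2)) ∂μ = 1)
    {g h : Lp ℂ 2 μ} {c : ℂ} (hgh : h =ᵐ[μ] fun x : ℝ => (x : ℂ) * g x - c) :
    Integrable (fun x : ℝ => g x - c * ((x : ℂ) / (1 + (x : ℂ) ^ 2))) μ ∧
      boundaryZero hμ (g, h) = c ∧
      boundaryOne hμ (g, h) = ∫ x : ℝ, (g x - c * ((x : ℂ) / (1 + (x : ℂ) ^ 2))) ∂μ := by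
  obtain ⟨p1, p2⟩ := inner_cauchyVector_sub hμ I_im_ne_zero hgh
  obtain ⟨n1, n2⟩ := inner_cauchyVector_sub hμ neg_I_im_ne_zero hgh
  simp only [Complex.conj_I, map_neg, neg_neg, sub_neg_eq_add, neg_smul] at p1 p2 n1 n2
  have hsq : ∀ x : ℝ, (1 : ℂ) + (x : ℂ) ^ 2 = ((x : ℂ) + I) * ((x : ℂ) - I) := fun x => by
    linear_combination Complex.I_sq
  have hpt : ∀ x : ℝ, (1 / 2 : ℂ) * ((g x - c / ((x : ℂ) + I)) + (g x - c / ((x : ℂ) - I))) =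
      g x - c * ((x : ℂ) / (1 + (x : ℂ) ^ 2)) := fun x => by
    have := ofReal_add_I_ne_zero x
    have := ofReal_sub_I_ne_zero x
    rw [hsq]
    field_simp
    ring
  have hpt' : ∀ x : ℝ, (g x - c / ((x : ℂ) + I)) - (g x - c / ((x : ℂ) - I)) =
      (2 * I * c) * (1 / (1 + (x : ℂ) ^ 2)) := fun x => by
    have := ofReal_add_I_ne_zero x
    have := ofReal_sub_I_ne_zero x
    rw [hsq]
    field_simp
    ring
  refine ⟨?_, ?_, ?_⟩
  · exact ((p1.add n1).const_mul (1 / 2 : ℂ)).congr (Filter.Eventually.of_forall hpt)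
  · rw [boundaryZero_apply, p2, n2, ← integral_sub p1 n1]
    simp only [hpt']
    rw [integral_const_mul, integral_complex_one_div_one_add_sq hμ]
    field_simp
  · rw [boundaryOne_apply, p2, n2, ← integral_add p1 n1, ← integral_const_mul]
    simp only [hpt]

/-! ### The model operators -/

theorem mem_graph_modelBdot_iff {f h : Lp ℂ 2 μ} :
    (f, h) ∈ (modelBdot μ).graph ↔
      (h =ᵐ[μ] fun x : ℝ => (x : ℂ) * f x) ∧ Integrable f μ ∧ ∫ x, f x ∂μ = 0 := by
  rw [LinearPMap.mem_graph_iff]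
  constructor
  · rintro ⟨⟨y, hy⟩, rfl, rfl⟩
    exact ⟨MemLp.coeFn_toLp hy.2, hy.1⟩
  · rintro ⟨h1, h2⟩
    have hd : MemLp (fun x : ℝ => (x : ℂ) * f x) 2 μ := (memLp_congr_ae h1).1 (Lp.memLp h)
    exact ⟨⟨f, h2, hd⟩, rfl, Lp.ext ((MemLp.coeFn_toLp hd).trans h1.symm)⟩

/-- The elements `(g, h)` with `(h, f) = (g, x f)` for all `f` in the domain of the symmetric
model operator are those with `h = x g - c`. -/
theorem exists_const_of_inner_eq (hμ : ∫⁻ x : ℝ, ENNReal.ofReal (1 / (1 + x ^ 2)) ∂μ = 1)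
    {g h : Lp ℂ 2 μ}
    (hgh : ∀ f f' : Lp ℂ 2 μ, (f, f') ∈ (modelBdot μ).graph → inner ℂ h f = inner ℂ g f') :
    ∃ c : ℂ, h =ᵐ[μ] fun x : ℝ => (x : ℂ) * g x - c := by
  have hle : ∀ x : ℝ, 1 ≤ ‖(x : ℂ) - I‖ ∧ |x| ≤ ‖(x : ℂ) - I‖ := fun x => by
    have h1 := Complex.abs_im_le_norm ((x : ℂ) - I)
    have h2 := Complex.abs_re_le_norm ((x : ℂ) - I)
    simp at h1 h2
    exact ⟨h1, h2⟩
  have hconj : ∀ x : ℝ, (starRingEnd ℂ) ((x : ℂ) + I) = (x : ℂ) - I := fun x => by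
    simp [sub_eq_add_neg]
  have hnorm : ∀ x : ℝ, ‖(x : ℂ) + I‖ = ‖(x : ℂ) - I‖ := fun x => by
    rw [← hconj, Complex.norm_conj]
  have b1 : ∀ (x : ℝ) (a : ℂ), ‖a / ((x : ℂ) - I)‖ ≤ 1 * ‖a‖ := fun x a => by
    rw [norm_div, one_mul]
    exact div_le_self (norm_nonneg _) (hle x).1
  have b2 : ∀ (x : ℝ) (a : ℂ), ‖(x : ℂ) * (a / ((x : ℂ) - I))‖ ≤ 1 * ‖a‖ := fun x a => by
    have := lt_of_lt_of_le one_pos (hle x).1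
    rw [norm_mul, norm_div, one_mul, Complex.norm_real, Real.norm_eq_abs, ← mul_div_assoc,
      div_le_iff₀ this, mul_comm]
    exact mul_le_mul_of_nonneg_left (hle x).2 (norm_nonneg _)
  have m1 : MemLp (fun x : ℝ => h x / ((x : ℂ) + I)) 2 μ := by
    refine (Lp.memLp h).of_le_mul (c := 1) ?_ (Filter.Eventually.of_forall fun x => ?_)
    · exact ((Lp.aestronglyMeasurable h).aemeasurable.div
        (Measurable.aemeasurable (by fun_prop))).aestronglyMeasurable
    · have := b1 x (h x)
      rwa [norm_div, ← hnorm, ← norm_div] at this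
  have m2 : MemLp (fun x : ℝ => (x : ℂ) * (g x / ((x : ℂ) + I))) 2 μ := by
    refine (Lp.memLp g).of_le_mul (c := 1) ?_ (Filter.Eventually.of_forall fun x => ?_)
    · exact AEStronglyMeasurable.mul (by fun_prop)
        (((Lp.aestronglyMeasurable g).aemeasurable.div
        (Measurable.aemeasurable (by fun_prop))).aestronglyMeasurable)
    · have := b2 x (g x)
      rwa [norm_mul, norm_div, ← hnorm, ← norm_div, ← norm_mul] at this
  -- The claim is that `W = (h - x g) / (x + i)` is a multiple of `n = 1 / (x + i)`. Its component
  -- `v` orthogonal to `n` yields the test function `v / (x - i)`, whose integral is `(n, v) = 0`;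
  -- testing gives `(W, v) = 0`, hence `v = 0`.
  let W : Lp ℂ 2 μ := m1.toLp _ - m2.toLp _
  have hW : W =ᵐ[μ] fun x : ℝ => (h x - (x : ℂ) * g x) / ((x : ℂ) + I) := by
    filter_upwards [Lp.coeFn_sub (m1.toLp _) (m2.toLp _), m1.coeFn_toLp, m2.coeFn_toLp]
      with x e1 e2 e3
    rw [e1, Pi.sub_apply, e2, e3]
    ring
  let n : Lp ℂ 2 μ := cauchyVector hμ neg_I_im_ne_zero
  have hn : inner ℂ n n = (1 : ℂ) := by
    rw [inner_self_eq_norm_sq_to_K, norm_cauchyVector_neg_I hμ]; simp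
  let v : Lp ℂ 2 μ := W - inner ℂ n W • n
  have hnv : inner ℂ n v = 0 := by
    simp only [v, inner_sub_right, inner_smul_right, hn, mul_one, sub_self]
  have mf : MemLp (fun x : ℝ => v x / ((x : ℂ) - I)) 2 μ := by
    refine (Lp.memLp v).of_le_mul (c := 1) ?_ (Filter.Eventually.of_forall fun x => b1 x _)
    exact ((Lp.aestronglyMeasurable v).aemeasurable.div
        (Measurable.aemeasurable (by fun_prop))).aestronglyMeasurable
  have mf' : MemLp (fun x : ℝ => (x : ℂ) * (v x / ((x : ℂ) - I))) 2 μ := by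
    refine (Lp.memLp v).of_le_mul (c := 1) ?_ (Filter.Eventually.of_forall fun x => b2 x _)
    exact AEStronglyMeasurable.mul (by fun_prop) (((Lp.aestronglyMeasurable v).aemeasurable.div
        (Measurable.aemeasurable (by fun_prop))).aestronglyMeasurable)
  have hgraph : (mf.toLp _, mf'.toLp _) ∈ (modelBdot μ).graph := by
    obtain ⟨i1, i2⟩ := inner_cauchyVector hμ neg_I_im_ne_zero v
    simp only [map_neg, Complex.conj_I, neg_neg] at i1 i2
    rw [mem_graph_modelBdot_iff]
    refine ⟨?_, i1.congr mf.coeFn_toLp.symm, ?_⟩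
    · filter_upwards [mf.coeFn_toLp, mf'.coeFn_toLp] with x e1 e2
      rw [e1, e2]
    · rw [integral_congr_ae mf.coeFn_toLp, ← i2]
      exact hnv
  have hWv : inner ℂ W v = 0 := by
    have h0 := sub_eq_zero.2 (hgh _ _ hgraph)
    rw [L2.inner_def, L2.inner_def, ← integral_sub (L2.integrable_inner _ _)
      (L2.integrable_inner _ _)] at h0
    rw [L2.inner_def, ← h0]
    refine integral_congr_ae ?_
    filter_upwards [hW, mf.coeFn_toLp, mf'.coeFn_toLp] with x e1 e2 e3
    rw [e1, e2, e3]
    simp only [RCLike.inner_apply, map_div₀, map_sub, map_mul, Complex.conj_ofReal, hconj]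
    ring
  have hv : v = 0 := by
    have : inner ℂ v v = 0 := by
      rw [show inner ℂ v v = inner ℂ (W - inner ℂ n W • n) v from rfl, inner_sub_left,
        inner_smul_left, hWv, hnv, mul_zero, sub_zero]
    exact inner_self_eq_zero.1 this
  have hWn : W = inner ℂ n W • n := sub_eq_zero.1 hv
  refine ⟨-inner ℂ n W, ?_⟩
  have hcoe : W =ᵐ[μ] (inner ℂ n W • n : Lp ℂ 2 μ) := by rw [← hWn]
  filter_upwards [hW, hcoe, Lp.coeFn_smul (inner ℂ n W) n, coeFn_cauchyVector hμ neg_I_im_ne_zero]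
    with x e1 e2 e3 e4
  have hne := ofReal_add_I_ne_zero x
  rw [e1, e3, Pi.smul_apply, e4, smul_eq_mul, sub_neg_eq_add, mul_one_div,
    div_left_inj' hne] at e2
  linear_combination e2

/-- A vector orthogonal to the domain satisfies the relation `h = x g - c` with `g = 0`, so it is
constant; since `μ` is infinite, a square integrable constant is zero. -/
theorem dense_domain_modelBdot (hμ : ∫⁻ x : ℝ, ENNReal.ofReal (1 / (1 + x ^ 2)) ∂μ = 1)
    (hinf : μ Set.univ = ⊤) : Dense ((modelBdot μ).domain : Set (Lp ℂ 2 μ)) := by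
  rw [Submodule.dense_iff_topologicalClosure_eq_top,
    Submodule.topologicalClosure_eq_top_iff, Submodule.eq_bot_iff]
  intro h hh
  rw [Submodule.mem_orthogonal'] at hh
  obtain ⟨c, hc⟩ := exists_const_of_inner_eq hμ (g := 0) (h := h) fun f f' hf => by
    rw [inner_zero_left]
    exact hh f (LinearPMap.mem_domain_of_mem_graph hf)
  have hc' : h =ᵐ[μ] fun _ => -c := by
    filter_upwards [hc, Lp.coeFn_zero ℂ 2 μ] with x e1 e2
    rw [e1, e2, Pi.zero_apply, mul_zero, zero_sub]
  have hmem : MemLp (fun _ : ℝ => -c) 2 μ := (memLp_congr_ae hc').1 (Lp.memLp h)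
  rw [memLp_const_iff (by simp) (by simp)] at hmem
  have hc0 : -c = 0 := by simpa [hinf] using hmem
  refine Lp.ext (hc'.trans ?_)
  filter_upwards [Lp.coeFn_zero ℂ 2 μ] with x e
  rw [e, hc0, Pi.zero_apply]

/-- The adjoint of the symmetric model operator. -/
theorem mem_graph_adjoint_modelBdot_iff
    (hμ : ∫⁻ x : ℝ, ENNReal.ofReal (1 / (1 + x ^ 2)) ∂μ = 1) (hinf : μ Set.univ = ⊤)
    {g h : Lp ℂ 2 μ} : (g, h) ∈ (modelBdot μ).adjoint.graph ↔
      ∃ c : ℂ, h =ᵐ[μ] fun x : ℝ => (x : ℂ) * g x - c := by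
  rw [LinearPMap.adjoint_graph_eq_graph_adjoint (dense_domain_modelBdot hμ hinf),
    Submodule.mem_adjoint_iff]
  constructor
  · intro hgh
    refine exists_const_of_inner_eq hμ fun f f' hf => ?_
    rw [← inner_conj_symm, ← inner_conj_symm g, sub_eq_zero.1 (hgh f f' hf)]
  · rintro ⟨c, hc⟩ f f' hf
    obtain ⟨h1, h2, h3⟩ := mem_graph_modelBdot_iff.1 hf
    rw [L2.inner_def, L2.inner_def, ← integral_sub (L2.integrable_inner _ _)
      (L2.integrable_inner _ _)]
    have h4 : ∫ x, c * (starRingEnd ℂ) (f x) ∂μ = 0 := by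
      rw [integral_const_mul, integral_conj, h3, map_zero, mul_zero]
    rw [← h4]
    refine integral_congr_ae ?_
    filter_upwards [hc, h1] with x e1 e2
    rw [e1, e2]
    simp only [RCLike.inner_apply, map_mul, Complex.conj_ofReal]
    ring

end Model

/-! ### The model as a boundary triple -/

section ModelTriple

variable {μ : Measure ℝ}

theorem smul_cauchyVector_ae_eq (hμ : ∫⁻ x : ℝ, ENNReal.ofReal (1 / (1 + x ^ 2)) ∂μ = 1) {z : ℂ}
    (hz : z.im ≠ 0) : (z • cauchyVector hμ hz : Lp ℂ 2 μ) =ᵐ[μ]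
      fun x : ℝ => (x : ℂ) * cauchyVector hμ hz x - 1 := by
  filter_upwards [Lp.coeFn_smul z (cauchyVector hμ hz), coeFn_cauchyVector hμ hz] with x e1 e2
  have hne := ofReal_sub_ne_zero hz x
  rw [e1, Pi.smul_apply, e2, smul_eq_mul]
  field_simp
  ring

theorem boundary_cauchyVector (hμ : ∫⁻ x : ℝ, ENNReal.ofReal (1 / (1 + x ^ 2)) ∂μ = 1) {z : ℂ}
    (hz : z.im ≠ 0) :
    boundaryZero hμ (cauchyVector hμ hz, z • cauchyVector hμ hz) = 1 ∧
      boundaryOne hμ (cauchyVector hμ hz, z • cauchyVector hμ hz) =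
        ∫ x : ℝ, (1 / ((x : ℂ) - z) - (x : ℂ) / (1 + (x : ℂ) ^ 2)) ∂μ := by
  obtain ⟨-, h1, h2⟩ := boundary_values hμ (smul_cauchyVector_ae_eq hμ hz)
  refine ⟨h1, h2.trans (integral_congr_ae ?_)⟩
  filter_upwards [coeFn_cauchyVector hμ hz] with x e
  rw [e, one_mul]

theorem boundaryOne_cauchyVector_of_sq (hμ : ∫⁻ x : ℝ, ENNReal.ofReal (1 / (1 + x ^ 2)) ∂μ = 1)
    {z : ℂ} (hz : z.im ≠ 0) (hz2 : z ^ 2 = -1) :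
    boundaryOne hμ (cauchyVector hμ hz, z • cauchyVector hμ hz) = z := by
  rw [(boundary_cauchyVector hμ hz).2]
  have h : ∀ x : ℝ, 1 / ((x : ℂ) - z) - (x : ℂ) / (1 + (x : ℂ) ^ 2) =
      z * (1 / (1 + (x : ℂ) ^ 2)) := fun x => by
    have h1 := ofReal_sub_ne_zero hz x
    have h2 : (x : ℂ) + z ≠ 0 := by
      have := ofReal_sub_ne_zero (z := -z) (by simpa using hz) x
      rwa [sub_neg_eq_add] at this
    rw [show (1 : ℂ) + (x : ℂ) ^ 2 = ((x : ℂ) - z) * ((x : ℂ) + z) by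
      linear_combination hz2]
    field_simp
    ring
  simp only [h]
  rw [integral_const_mul, integral_complex_one_div_one_add_sq hμ, mul_one]

theorem mem_graph_modelBdot_iff_boundary
    (hμ : ∫⁻ x : ℝ, ENNReal.ofReal (1 / (1 + x ^ 2)) ∂μ = 1) (hinf : μ Set.univ = ⊤)
    {u : Lp ℂ 2 μ × Lp ℂ 2 μ} : u ∈ (modelBdot μ).graph ↔
      u ∈ (modelBdot μ).adjoint.graph ∧ boundaryZero hμ u = 0 ∧ boundaryOne hμ u = 0 := by
  obtain ⟨f, h⟩ := u
  rw [mem_graph_adjoint_modelBdot_iff hμ hinf, mem_graph_modelBdot_iff]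
  constructor
  · rintro ⟨h1, h2, h3⟩
    have h1' : h =ᵐ[μ] fun x : ℝ => (x : ℂ) * f x - 0 := by simpa only [sub_zero] using h1
    obtain ⟨-, b0, b1⟩ := boundary_values hμ h1'
    simp only [zero_mul, sub_zero] at b1
    exact ⟨⟨0, h1'⟩, b0, b1.trans h3⟩
  · rintro ⟨⟨c, hc⟩, h0, h1⟩
    obtain ⟨i, b0, b1⟩ := boundary_values hμ hc
    have hc0 : c = 0 := b0.symm.trans h0
    subst hc0
    simp only [zero_mul, sub_zero] at hc i b1
    exact ⟨hc, i, b1.symm.trans h1⟩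

theorem cauchyVector_mem_graph (hμ : ∫⁻ x : ℝ, ENNReal.ofReal (1 / (1 + x ^ 2)) ∂μ = 1)
    (hinf : μ Set.univ = ⊤) {z : ℂ} (hz : z.im ≠ 0) :
    (cauchyVector hμ hz, z • cauchyVector hμ hz) ∈ (modelBdot μ).adjoint.graph :=
  (mem_graph_adjoint_modelBdot_iff hμ hinf).2 ⟨1, smul_cauchyVector_ae_eq hμ hz⟩

/-- Pointwise, `x conj g₁ g₂` cancels on the left, leaving `conj c₁ g₂ - c₂ conj g₁`. The
regularizing terms on the right are both `conj c₁ c₂ x / (1 + x²)` and cancel too. -/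
theorem model_green (hμ : ∫⁻ x : ℝ, ENNReal.ofReal (1 / (1 + x ^ 2)) ∂μ = 1)
    {g₁ h₁ g₂ h₂ : Lp ℂ 2 μ} {c₁ c₂ : ℂ} (H₁ : h₁ =ᵐ[μ] fun x : ℝ => (x : ℂ) * g₁ x - c₁)
    (H₂ : h₂ =ᵐ[μ] fun x : ℝ => (x : ℂ) * g₂ x - c₂) :
    inner ℂ g₁ h₂ - inner ℂ h₁ g₂ =
      (starRingEnd ℂ) (boundaryZero hμ (g₁, h₁)) * boundaryOne hμ (g₂, h₂) -
        (starRingEnd ℂ) (boundaryOne hμ (g₁, h₁)) * boundaryZero hμ (g₂, h₂) := by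
  obtain ⟨i₁, a₁, b₁⟩ := boundary_values hμ H₁
  obtain ⟨i₂, a₂, b₂⟩ := boundary_values hμ H₂
  have i₁' : Integrable (fun x : ℝ =>
      (starRingEnd ℂ) (g₁ x - c₁ * ((x : ℂ) / (1 + (x : ℂ) ^ 2)))) μ :=
    (LinearIsometryEquiv.integrable_comp_iff Complex.conjLIE).2 i₁
  rw [a₁, a₂, b₁, b₂, ← integral_conj, ← integral_const_mul, ← integral_mul_const,
    L2.inner_def, L2.inner_def, ← integral_sub (L2.integrable_inner _ _)
      (L2.integrable_inner _ _), ← integral_sub (i₂.const_mul _)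
      (i₁'.mul_const _)]
  refine integral_congr_ae ?_
  filter_upwards [H₁, H₂] with x e1 e2
  rw [e1, e2]
  simp only [RCLike.inner_apply, map_mul, map_sub, map_div₀, map_add, map_one, map_pow,
    Complex.conj_ofReal]
  ring

theorem isBoundaryTriple_model (hμ : ∫⁻ x : ℝ, ENNReal.ofReal (1 / (1 + x ^ 2)) ∂μ = 1)
    (hinf : μ Set.univ = ⊤) :
    IsBoundaryTriple (modelBdot μ).adjoint.graph (boundaryZero hμ) (boundaryOne hμ) where
  isClosed := LinearPMap.adjoint_isClosed (dense_domain_modelBdot hμ hinf)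
  green := by
    rintro ⟨g₁, h₁⟩ hu ⟨g₂, h₂⟩ hv
    obtain ⟨c₁, H₁⟩ := (mem_graph_adjoint_modelBdot_iff hμ hinf).1 hu
    obtain ⟨c₂, H₂⟩ := (mem_graph_adjoint_modelBdot_iff hμ hinf).1 hv
    exact model_green hμ H₁ H₂
  surjective := by
    intro a b
    -- The deficiency vectors at `±i` have boundary values `(1, ±i)`; the coefficients solve the
    -- resulting two by two system.
    refine ⟨((a - I * b) / 2) • (cauchyVector hμ I_im_ne_zero, I • cauchyVector hμ I_im_ne_zero) +
      ((a + I * b) / 2) • (cauchyVector hμ neg_I_im_ne_zero,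
        (-I) • cauchyVector hμ neg_I_im_ne_zero),
      Submodule.add_mem _ (Submodule.smul_mem _ _ (cauchyVector_mem_graph hμ hinf _))
        (Submodule.smul_mem _ _ (cauchyVector_mem_graph hμ hinf _)), ?_, ?_⟩
    · rw [map_add, map_smul, map_smul, (boundary_cauchyVector hμ _).1,
        (boundary_cauchyVector hμ _).1]
      simp only [smul_eq_mul]
      ring
    · rw [map_add, map_smul, map_smul, boundaryOne_cauchyVector_of_sq hμ _ (by simp),
        boundaryOne_cauchyVector_of_sq hμ _ (by simp)]
      simp only [smul_eq_mul]
      linear_combination -b * Complex.I_sq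
  maximal := by
    intro g h hgh
    refine (mem_graph_adjoint_modelBdot_iff hμ hinf).2 (exists_const_of_inner_eq hμ ?_)
    intro f f' hf
    obtain ⟨h1, h2, h3⟩ := (mem_graph_modelBdot_iff_boundary hμ hinf).1 hf
    exact hgh (f, f') h1 h2 h3

theorem boundary_cauchyVector_sub (hμ : ∫⁻ x : ℝ, ENNReal.ofReal (1 / (1 + x ^ 2)) ∂μ = 1)
    (κ : ℂ) :
    boundaryZero hμ ((cauchyVector hμ I_im_ne_zero, I • cauchyVector hμ I_im_ne_zero) -
        κ • (cauchyVector hμ neg_I_im_ne_zero, (-I) • cauchyVector hμ neg_I_im_ne_zero)) = 1 - κ ∧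
      boundaryOne hμ ((cauchyVector hμ I_im_ne_zero, I • cauchyVector hμ I_im_ne_zero) -
        κ • (cauchyVector hμ neg_I_im_ne_zero, (-I) • cauchyVector hμ neg_I_im_ne_zero)) =
        I * (1 + κ) := by
  constructor
  · rw [map_sub, map_smul, (boundary_cauchyVector hμ _).1, (boundary_cauchyVector hμ _).1,
      smul_eq_mul, mul_one]
  · rw [map_sub, map_smul, boundaryOne_cauchyVector_of_sq hμ _ (by simp),
      boundaryOne_cauchyVector_of_sq hμ _ (by simp), smul_eq_mul]
    ring

/-- The dissipative model extension is given by a boundary condition. -/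
theorem mem_graph_modelBhat_iff (hμ : ∫⁻ x : ℝ, ENNReal.ofReal (1 / (1 + x ^ 2)) ∂μ = 1)
    (hinf : μ Set.univ = ⊤) {κ m : ℂ} (hκ : κ ≠ 1) (hm : m * (1 - κ) = I * (1 + κ))
    {g h : Lp ℂ 2 μ} : (g, h) ∈ (modelBhat μ κ).graph ↔
      (g, h) ∈ (modelBdot μ).adjoint.graph ∧
        boundaryOne hμ (g, h) = m * boundaryZero hμ (g, h) := by
  have hκ' : 1 - κ ≠ 0 := sub_ne_zero.2 hκ.symm
  set p : Lp ℂ 2 μ × Lp ℂ 2 μ := (cauchyVector hμ I_im_ne_zero, I • cauchyVector hμ I_im_ne_zero)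
  set n : Lp ℂ 2 μ × Lp ℂ 2 μ :=
    (cauchyVector hμ neg_I_im_ne_zero, (-I) • cauchyVector hμ neg_I_im_ne_zero)
  set e : Lp ℂ 2 μ × Lp ℂ 2 μ := p - κ • n with he
  have hpG : p ∈ (modelBdot μ).adjoint.graph := cauchyVector_mem_graph hμ hinf _
  have hnG : n ∈ (modelBdot μ).adjoint.graph := cauchyVector_mem_graph hμ hinf _
  have heG : e ∈ (modelBdot μ).adjoint.graph :=
    Submodule.sub_mem _ hpG (Submodule.smul_mem _ _ hnG)
  have he0 : boundaryZero hμ e = 1 - κ := (boundary_cauchyVector_sub hμ κ).1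
  have he1 : boundaryOne hμ e = m * (1 - κ) := (boundary_cauchyVector_sub hμ κ).2.trans hm.symm
  have hset : {f : Lp ℂ 2 μ | f =ᵐ[μ] fun x : ℝ =>
      1 / ((x : ℂ) - I) - κ * (1 / ((x : ℂ) + I))} = {e.1} := by
    have hee : (e.1 : Lp ℂ 2 μ) =ᵐ[μ] fun x : ℝ =>
        1 / ((x : ℂ) - I) - κ * (1 / ((x : ℂ) + I)) := by
      change (cauchyVector hμ I_im_ne_zero - κ • cauchyVector hμ neg_I_im_ne_zero : Lp ℂ 2 μ)
        =ᵐ[μ] _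
      filter_upwards [Lp.coeFn_sub (cauchyVector hμ I_im_ne_zero)
        (κ • cauchyVector hμ neg_I_im_ne_zero), Lp.coeFn_smul κ (cauchyVector hμ neg_I_im_ne_zero),
        coeFn_cauchyVector hμ I_im_ne_zero, coeFn_cauchyVector hμ neg_I_im_ne_zero]
        with x e1 e2 e3 e4
      rw [e1, Pi.sub_apply, e2, Pi.smul_apply, e3, e4, smul_eq_mul, sub_neg_eq_add]
    ext f
    exact ⟨fun hf => Lp.ext (Filter.EventuallyEq.trans hf hee.symm), fun hf => by
      rw [Set.mem_singleton_iff] at hf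
      rw [hf]
      exact hee⟩
  have hgraph : (g, h) ∈ (modelBhat μ κ).graph ↔ (g, h) ∈ (modelBdot μ).adjoint.graph ∧
      g ∈ (modelBdot μ).domain ⊔ Submodule.span ℂ {e.1} := by
    rw [← hset, LinearPMap.mem_graph_iff, LinearPMap.mem_graph_iff]
    constructor
    · rintro ⟨⟨y, hy⟩, rfl, rfl⟩
      exact ⟨⟨⟨y, hy.2⟩, rfl, rfl⟩, hy.1⟩
    · rintro ⟨⟨⟨y, hy⟩, rfl, rfl⟩, hg⟩
      exact ⟨⟨y, hg, hy⟩, rfl, rfl⟩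
  rw [hgraph]
  refine and_congr_right fun hG => ?_
  constructor
  · intro hg
    obtain ⟨f, hf, w, hw, hfw⟩ := Submodule.mem_sup.1 hg
    obtain ⟨a, rfl⟩ := Submodule.mem_span_singleton.1 hw
    obtain ⟨f', hff'⟩ := LinearPMap.mem_domain_iff.1 hf
    obtain ⟨f1, f2, f3⟩ := (mem_graph_modelBdot_iff_boundary hμ hinf).1 hff'
    have hsum : ((f, f') : Lp ℂ 2 μ × Lp ℂ 2 μ) + a • e ∈ (modelBdot μ).adjoint.graph :=
      Submodule.add_mem _ f1 (Submodule.smul_mem _ _ heG)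
    have heq : (g, h) = ((f, f') : Lp ℂ 2 μ × Lp ℂ 2 μ) + a • e :=
      Prod.ext hfw.symm (LinearPMap.mem_graph_snd_inj' _ hG hsum hfw.symm)
    rw [heq, map_add, map_add, map_smul, map_smul, f2, f3, he0, he1]
    simp only [smul_eq_mul]
    ring
  · intro hb
    -- Subtracting the multiple of `e` with the same `Γ₀` also kills `Γ₁`, because both satisfy `Γ₁
    -- = m Γ₀`.
    have hD : ((g, h) : Lp ℂ 2 μ × Lp ℂ 2 μ) - (boundaryZero hμ (g, h) / (1 - κ)) • e ∈
        (modelBdot μ).graph := by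
      refine (mem_graph_modelBdot_iff_boundary hμ hinf).2
        ⟨Submodule.sub_mem _ hG (Submodule.smul_mem _ _ heG), ?_, ?_⟩
      · rw [map_sub, map_smul, he0, smul_eq_mul, div_mul_cancel₀ _ hκ', sub_self]
      · rw [map_sub, map_smul, he1, hb, smul_eq_mul]
        field_simp
        ring
    have hD1 : g - (boundaryZero hμ (g, h) / (1 - κ)) • e.1 ∈ (modelBdot μ).domain :=
      LinearPMap.mem_domain_of_mem_graph hD
    have hsum := Submodule.add_mem_sup hD1 (Submodule.smul_mem _
      (boundaryZero hμ (g, h) / (1 - κ)) (Submodule.mem_span_singleton_self (R := ℂ) e.1))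
    rwa [sub_add_cancel] at hsum

/-- The Weyl function of the model is a Herglotz function. -/
theorem boundaryOne_cauchyVector_im_pos
    (hμ : ∫⁻ x : ℝ, ENNReal.ofReal (1 / (1 + x ^ 2)) ∂μ = 1) {z : ℂ} (hz : 0 < z.im) :
    0 < (boundaryOne hμ (cauchyVector hμ hz.ne', z • cauchyVector hμ hz.ne')).im := by
  -- Green's identity for the deficiency vector with itself reads `Im M = Im z ‖g‖²`.
  have h := model_green hμ (smul_cauchyVector_ae_eq hμ hz.ne') (smul_cauchyVector_ae_eq hμ hz.ne')
  have h0 := (boundary_cauchyVector hμ hz.ne').1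
  have hne : cauchyVector hμ hz.ne' ≠ 0 := by
    intro h'
    rw [h', smul_zero, Prod.mk_zero_zero, map_zero] at h0
    exact zero_ne_one h0
  rw [h0, map_one, one_mul, mul_one, inner_smul_left, inner_smul_right, ← sub_mul,
    Complex.sub_conj, Complex.sub_conj, inner_self_eq_norm_sq_to_K] at h
  have h2 := congrArg Complex.im h
  have h3 : 0 < ‖cauchyVector hμ hz.ne'‖ ^ 2 := by positivity
  have h4 : ((‖cauchyVector hμ hz.ne'‖ : ℂ)) ^ 2 = ((‖cauchyVector hμ hz.ne'‖ ^ 2 : ℝ) : ℂ) := by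
    push_cast; rfl
  change ((2 * z.im : ℝ) * I * (‖cauchyVector hμ hz.ne'‖ : ℂ) ^ 2).im = _ at h2
  rw [h4] at h2
  simp only [Complex.mul_im, Complex.mul_re, Complex.ofReal_re, Complex.ofReal_im, Complex.I_re,
    Complex.I_im] at h2
  nlinarith [mul_pos hz h3]

end ModelTriple

/-! ### The characteristic function of the model and its value at zero -/

/-- The parameter of the boundary condition of the dissipative extension. -/
theorem im_pos_of_mul_one_sub_eq {κ m : ℂ} (hκ : ‖κ‖ < 1) (hm : m * (1 - κ) = I * (1 + κ)) :
    0 < m.im := by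
  have hκ1 : κ ≠ 1 := by rintro rfl; simp at hκ
  -- Clearing the denominator gives `Im m |1 - κ|² = 1 - |κ|²`.
  have hm' : m * ((1 - κ) * (starRingEnd ℂ) (1 - κ)) =
      I * ((1 + κ) * (starRingEnd ℂ) (1 - κ)) := by linear_combination (starRingEnd ℂ) (1 - κ) * hm
  rw [Complex.mul_conj] at hm'
  have h1 := congrArg Complex.im hm'
  rw [Complex.im_mul_ofReal] at h1
  have h2 : (I * ((1 + κ) * (starRingEnd ℂ) (1 - κ))).im = 1 - ‖κ‖ ^ 2 := by
    rw [← Complex.normSq_eq_norm_sq, Complex.normSq_apply]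
    simp
    ring
  rw [h2] at h1
  have h3 : 0 < normSq (1 - κ) := Complex.normSq_pos.2 (sub_ne_zero.2 hκ1.symm)
  have h4 : 0 < 1 - ‖κ‖ ^ 2 := by nlinarith [norm_nonneg κ]
  rw [← h1] at h4
  exact pos_of_mul_pos_left h4 h3.le

theorem tendsto_neg_one_div_cobounded :
    Filter.Tendsto (fun z : ℂ => -1 / z) (nhdsWithin 0 {z : ℂ | 0 < z.im})
      (Bornology.cobounded ℂ) := by
  have h1 : Filter.Tendsto (fun z : ℂ => -z) (nhdsWithin 0 {z : ℂ | 0 < z.im})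
      (nhdsWithin 0 {0}ᶜ) := by
    refine tendsto_nhdsWithin_iff.2 ⟨?_, ?_⟩
    · have : Filter.Tendsto (fun z : ℂ => -z) (nhds 0) (nhds (-0)) := continuous_neg.tendsto 0
      rw [neg_zero] at this
      exact this.mono_left nhdsWithin_le_nhds
    · filter_upwards [self_mem_nhdsWithin] with z hz
      simp only [Set.mem_compl_iff, Set.mem_singleton_iff, neg_eq_zero]
      rintro rfl
      simp at hz
  refine (Filter.tendsto_inv₀_nhdsNE_zero.comp h1).congr fun z => ?_
  simp [neg_div, inv_neg]

theorem mainTheorem3 (S s : ℂ → ℂ) (κ : ℂ) (μ : Measure ℝ) (hmodel : IsModelData S s κ μ)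
    (h0 : IsQuasiRegularPoint (modelBdot μ) 0) :
    IsTripleCharacteristicFunction (modelBdot μ) (modelBhat μ κ) (modelB μ) S ∧
    ∃ (T : Lp ℂ 2 μ →L[ℂ] Lp ℂ 2 μ) (S₀ : ℂ),
      IsBoundedInverse (modelBhat μ κ) T ∧
      IsBoundedDissipative (-T) ∧
      Module.finrank ℂ (LinearMap.range ((ℑ (-T) : Lp ℂ 2 μ →L[ℂ] Lp ℂ 2 μ) :
        Lp ℂ 2 μ →ₗ[ℂ] Lp ℂ 2 μ)) = 1 ∧
      Filter.Tendsto S (nhdsWithin 0 {z : ℂ | 0 < z.im}) (nhds S₀) ∧ S₀ ≠ 0 ∧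
      ∀ z : ℂ, 0 < z.im → livsicCharacteristicFunction (-T) (-1 / z) = S z / S₀ := by
  have hμ := hmodel.normalized
  have hinf := hmodel.measure_univ
  have hκ := hmodel.norm_kappa_lt
  have hκ1 : κ ≠ 1 := by rintro rfl; simp at hκ
  have hκ1' : 1 - κ ≠ 0 := sub_ne_zero.2 hκ1.symm
  have hκc : 1 - (starRingEnd ℂ) κ ≠ 0 := by
    have := (map_ne_zero (starRingEnd ℂ)).2 hκ1'
    rwa [map_sub, map_one] at this
  obtain ⟨m, hm⟩ : ∃ m : ℂ, m * (1 - κ) = I * (1 + κ) :=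
    ⟨I * (1 + κ) / (1 - κ), div_mul_cancel₀ _ hκ1'⟩
  have hmc : (starRingEnd ℂ) m * (1 - (starRingEnd ℂ) κ) = -I * (1 + (starRingEnd ℂ) κ) := by
    simpa using congrArg (starRingEnd ℂ) hm
  have hmpos := im_pos_of_mul_one_sub_eq hκ hm
  have hG := isBoundaryTriple_model hμ hinf
  have hweyl : ∀ z : ℂ, ∀ hz : 0 < z.im, ∃ M : ℂ,
      boundaryOne hμ (cauchyVector hμ hz.ne', z • cauchyVector hμ hz.ne') = M ∧ 0 < M.im ∧
      s z ≠ 1 ∧ M * (s z - 1) = -I * (s z + 1) := by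
    intro z hz
    refine ⟨_, rfl, boundaryOne_cauchyVector_im_pos hμ hz, ?_⟩
    have hrep := hmodel.representation z hz
    rw [← (boundary_cauchyVector hμ hz.ne').2] at hrep
    -- If `s z = 1`, division by zero evaluates to `0` and the representation would give `M = 0`,
    -- against `Im M > 0`.
    have hs : s z ≠ 1 := by
      intro h
      have hpos := boundaryOne_cauchyVector_im_pos hμ hz
      rw [← hrep, h] at hpos
      simp at hpos
    have hs' := sub_ne_zero.2 hs
    refine ⟨hs, ?_⟩
    rw [← hrep, mul_assoc, div_mul_cancel₀ _ hs', one_div, Complex.inv_I]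
  constructor
  · refine ⟨cauchyVector hμ I_im_ne_zero, cauchyVector hμ neg_I_im_ne_zero, κ,
      cauchyVector_mem_graph hμ hinf _, cauchyVector_mem_graph hμ hinf _,
      norm_cauchyVector_I hμ, norm_cauchyVector_neg_I hμ, ?_, hκ, ?_, ?_⟩
    · have hmem : MemLp (fun x : ℝ => (x : ℂ) *
          (cauchyVector hμ I_im_ne_zero - cauchyVector hμ neg_I_im_ne_zero : Lp ℂ 2 μ) x) 2 μ := by
        refine (memLp_congr_ae ?_).1 (Lp.memLp (I • cauchyVector hμ I_im_ne_zero -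
          (-I) • cauchyVector hμ neg_I_im_ne_zero))
        filter_upwards [Lp.coeFn_sub (cauchyVector hμ I_im_ne_zero)
          (cauchyVector hμ neg_I_im_ne_zero), Lp.coeFn_sub (I • cauchyVector hμ I_im_ne_zero)
          ((-I) • cauchyVector hμ neg_I_im_ne_zero), smul_cauchyVector_ae_eq hμ I_im_ne_zero,
          smul_cauchyVector_ae_eq hμ neg_I_im_ne_zero] with x e1 e2 e3 e4
        rw [e1, e2, Pi.sub_apply, Pi.sub_apply, e3, e4]
        ring
      exact hmem
    · obtain ⟨b0, b1⟩ := boundary_cauchyVector_sub hμ κ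
      exact LinearPMap.mem_domain_of_mem_graph ((mem_graph_modelBhat_iff hμ hinf hκ1 hm).2
        ⟨Submodule.sub_mem _ (cauchyVector_mem_graph hμ hinf I_im_ne_zero)
          (Submodule.smul_mem _ κ (cauchyVector_mem_graph hμ hinf neg_I_im_ne_zero)),
          b1.trans (by rw [← hm, ← b0]; rfl)⟩)
    intro z hz
    obtain ⟨M, hM, hMpos, hs, hMs⟩ := hweyl z hz
    have hz1 := (boundary_cauchyVector hμ hz.ne').1
    rw [boundaryOne_apply, ← add_smul, ← sub_smul, inner_smul_right, inner_smul_right] at hM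
    rw [boundaryZero_apply, ← add_smul, ← sub_smul, inner_smul_right, inner_smul_right, one_div,
      inv_mul_eq_iff_eq_mul₀ (by simp)] at hz1
    -- The combinations `Γ₁ ± i Γ₀` isolate the two inner products, so the Livšic function of the
    -- triple is `(M - i) / (M + i) = s`.
    have hp : (z + I) * inner ℂ (cauchyVector hμ I_im_ne_zero) (cauchyVector hμ hz.ne') = M + I := by
      linear_combination hM + (1 / 2) * hz1
    have hn : (z - I) * inner ℂ (cauchyVector hμ neg_I_im_ne_zero) (cauchyVector hμ hz.ne') =
        M - I := by
      linear_combination hM - (1 / 2) * hz1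
    have hMI : M + I ≠ 0 := by
      intro h
      have := congrArg Complex.im h
      simp at this
      linarith
    have hpne := right_ne_zero_of_mul (hp ▸ hMI)
    refine ⟨cauchyVector hμ hz.ne', fun h => hpne (by rw [h, inner_zero_right]),
      cauchyVector_mem_graph hμ hinf _, hpne, s z, ?_, hmodel.S_eq z hz⟩
    rw [div_mul_div_comm, hp, hn, eq_div_iff hMI]
    linear_combination hMs
  obtain ⟨k, hk, hreg⟩ := h0
  obtain ⟨T, ω, hT, hdiss, hrank, hlim, hω, hform⟩ := hG.exists_inverse_livsic hk (by
    rintro ⟨f, h⟩ hu hu0 hu1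
    have hgr := (mem_graph_modelBdot_iff_boundary hμ hinf).2 ⟨hu, hu0, hu1⟩
    obtain ⟨y, rfl, rfl⟩ := (LinearPMap.mem_graph_iff _).1 hgr
    simpa using hreg y) hmpos
  have hS₀ : -((1 - κ) / (1 - (starRingEnd ℂ) κ)) * ω ≠ 0 :=
    mul_ne_zero (neg_ne_zero.2 (div_ne_zero hκ1' hκc)) hω
  have hS : ∀ z : ℂ, 0 < z.im → S z = -((1 - κ) / (1 - (starRingEnd ℂ) κ)) * ω *
      livsicCharacteristicFunction (-T) (-1 / z) := by
    intro z hz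
    obtain ⟨M, hM, hMpos, hs, hMs⟩ := hweyl z hz
    have hf := hform z _ hz (cauchyVector_mem_graph hμ hinf hz.ne')
      (boundary_cauchyVector hμ hz.ne').1
    rw [hM] at hf
    have hs' := sub_ne_zero.2 hs
    -- The quotient of `e1` by `e2` is `S = -((1 - κ) / (1 - conj κ)) (M - m) / (M - conj m)`; `hf`
    -- replaces the last factor by `ω L`.
    have e1 : (M - m) * (1 - κ) * (s z - 1) = -2 * I * (s z - κ) := by
      linear_combination (1 - κ) * hMs - (s z - 1) * hm
    have e2 : (M - (starRingEnd ℂ) m) * (1 - (starRingEnd ℂ) κ) * (s z - 1) =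
        2 * I * ((starRingEnd ℂ) κ * s z - 1) := by
      linear_combination (1 - (starRingEnd ℂ) κ) * hMs - (s z - 1) * hmc
    have hMm : M - (starRingEnd ℂ) m ≠ 0 := by
      intro h
      have := congrArg Complex.im h
      simp at this
      linarith
    have hden : (starRingEnd ℂ) κ * s z - 1 ≠ 0 := by
      intro h
      rw [h, mul_zero] at e2
      exact mul_ne_zero (mul_ne_zero hMm hκc) hs' e2
    rw [hmodel.S_eq z hz, div_eq_iff hden]
    have hI2 : (2 * I : ℂ) ≠ 0 := by simp
    have hq := div_mul_cancel₀ (1 - κ) hκc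
    generalize (1 - κ) / (1 - (starRingEnd ℂ) κ) = q at hq ⊢
    generalize livsicCharacteristicFunction (-T) (-1 / z) = L at hf ⊢
    apply mul_left_cancel₀ hI2
    linear_combination e1 - q * ω * L * e2 +
      ω * L * (M - (starRingEnd ℂ) m) * (s z - 1) * hq - (1 - κ) * (s z - 1) * hf
  refine ⟨T, -((1 - κ) / (1 - (starRingEnd ℂ) κ)) * ω, ?_, hdiss, hrank, ?_, hS₀, ?_⟩
  · intro f h
    rw [mem_graph_modelBhat_iff hμ hinf hκ1 hm]
    exact hT f h
  -- As `z → 0`, `-1/z` tends to infinity, where `L → 1`; only the constant factor remains.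
  · have h1 := (hlim.comp tendsto_neg_one_div_cobounded).const_mul
      (-((1 - κ) / (1 - (starRingEnd ℂ) κ)) * ω)
    rw [mul_one] at h1
    refine h1.congr' ?_
    filter_upwards [self_mem_nhdsWithin] with z hz
    exact (hS z hz).symm
  · intro z hz
    rw [hS z hz, mul_div_cancel_left₀ _ hS₀]
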